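/- Let $\mathbb D$ be the open unit disc of $\mathbb C$, let $dA$ be the normalized area measure on $\mathbb D$ (total mass $1$), and let $d\lambda(z)=(1-|z|^2)^{-2}\,dA(z)$. For $h$ holomorphic on $\mathbb D$ and $p>1$ put $$\|h\|_{\mathcal B^p}=\Big(\int_{\mathbb D}\big((1-|z|^2)\,|h'(z)|\big)^p\,d\lambda(z)\Big)^{1/p}\in[0,\infty].$$ For $f$ holomorphic on $\mathbb D$ put $$\|f\|_{H^1}=\sup_{0\le r<1}\frac1{2\pi}\int_0^{2\pi}|f(re^{i\theta})|\,d\theta\in[0,\infty],$$ let $H^1$ be the space of holomorphic $f$ on $\mathbb D$ with $\|f\|_{H^1}<\infty$, and let $H'$ be the space of holomorphic $h$ on $\mathbb D$ with $h'\in H^1$. Then $$H'=\Big\{h \text{ holomorphic on } \mathbb D:\ \sup_{p\in(1,2]}(p-1)\,\|h\|_{\mathcal B^p}<\infty\Big\}.$$ Moreover, for every $h\in H'$, the radial limit $h'(e^{i\theta}):=\lim_{r\to1^-}h'(re^{i\theta})$ exists for almost every $\theta$, and $$\|h\|_{H'}:=\frac1{2\pi}\int_0^{2\pi}|h'(e^{i\theta})|\,d\theta=\|h'\|_{H^1}=\lim_{p\to1^+}(p-1)\,\|h\|_{\mathcal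 B^p}.$$ -/

import Mathlib

open Set Filter Topology MeasureTheory

open scoped ENNReal

namespace BesovHardy

noncomputable section

/-- The open unit disc of `ℂ`. -/
def disc : Set ℂ := Metric.ball 0 1

/-- Holomorphic functions on the unit disc. They are represented by functions `ℂ → ℂ`;
none of the notions below depends on the values outside the disc. -/
def Hol : Set (ℂ → ℂ) := {f | DifferentiableOn ℂ f disc}

/-- The normalized Lebesgue measure `dθ / 2π` in the angular variable `θ ∈ (0, 2π]`. -/
def circleMeasure : Measure ℝ :=
  (ENNReal.ofReal (2 * Real.pi))⁻¹ • volume.restrict (Ioc 0 (2 * Real.pi))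

/-- The normalized area measure on the unit disc. -/
def areaMeasure : Measure ℂ := (ENNReal.ofReal Real.pi)⁻¹ • volume.restrict disc

/-- The Möbius invariant measure `dλ(z) = (1 - |z|²)⁻² dA(z)` on the unit disc. -/
def mobiusMeasure : Measure ℂ :=
  areaMeasure.withDensity fun z => ENNReal.ofReal (1 / (1 - ‖z‖ ^ 2) ^ 2)

/-- The norm of `H¹`, the supremum over `0 ≤ r < 1` of the mean of `|f|` over the circle of
radius `r`; it takes the value `⊤` if the means are unbounded. -/
def hardyNorm (f : ℂ → ℂ) : ℝ≥0∞ :=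
  ⨆ r ∈ Ico (0 : ℝ) 1, ∫⁻ θ, ‖f (circleMap 0 r θ)‖ₑ ∂circleMeasure

/-- The Hardy space `H¹` of the unit disc. -/
def hardySpace : Set (ℂ → ℂ) := {f | f ∈ Hol ∧ hardyNorm f < ⊤}

/-- The space `H'` of holomorphic functions whose derivative belongs to `H¹`. -/
def hPrime : Set (ℂ → ℂ) := {h | h ∈ Hol ∧ deriv h ∈ hardySpace}

/-- The radial limit `lim_{r → 1⁻} f (r e^{iθ})` (a meaningless value where there is none). -/
def radialLimit (f : ℂ → ℂ) (θ : ℝ) : ℂ :=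
  limUnder (𝓝[<] (1 : ℝ)) fun r => f (circleMap 0 r θ)

/-- The seminorm of `H'`, the mean over the unit circle of the absolute value of the boundary
function of the derivative. -/
def hPrimeSeminorm (h : ℂ → ℂ) : ℝ≥0∞ :=
  ∫⁻ θ, ‖radialLimit (deriv h) θ‖ₑ ∂circleMeasure

/-- The seminorm of the Besov space `B^p`, the `L^p(λ)` norm of `(1 - |z|²) |h'(z)|`; it takes
the value `⊤` if `h` is not in `B^p`. -/
def besovNorm (p : ℝ) (h : ℂ → ℂ) : ℝ≥0∞ :=
  (∫⁻ z, ENNReal.ofReal (((1 - ‖z‖ ^ 2) * ‖deriv h z‖) ^ p) ∂mobiusMeasure) ^ (1 / p)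

end

end BesovHardy

namespace BesovHardy

/-! Write `g = h'`. In polar coordinates `(p - 1) ‖h‖^p` in `B^p` is the average of `∫
|g(re^{iθ})|^p dθ/2π` against the probability density `2(p - 1) r (1 - r²)^(p-2)` on `(0, 1)`, which
concentrates at `r = 1` as `p → 1`. Passing from the `p`-th power to the norm costs the factor `(p -
1)^(1 - 1/p)`, which tends to `1`.

Lower bound (`le_besovMean`): circle means increase with the radius and are bounded by the `L^p`
means, so radii beyond `s` already contribute `(1 - s²)^(p-1) M(s)^p`, with `M(s)` the mean of
`|g|`. Let `p → 1`, then `s → 1`.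

Upper bound (`besovMean_le`): a crude estimate by the `p`-th power of the maximal function `n(θ) =
sup_{r ≥ s} |g(re^{iθ})|` would need `n ∈ L^p`. The growth `|g| ≤ A/(1 - r²)` repairs this:
splitting each radius where `1 - r² = A/n` gives `p A^(p-1) n`, linear in `n`. The remaining radii
below `s` are negligible as `p → 1`, so the limsup is at most `∫ n`. Dominated convergence as `s →
1` replaces `n` by the boundary values, whose mean is at most the `H¹` norm by Fatou's lemma. The
two bounds force all the quantities to agree (`hPrimeSeminorm_eq`).

The inputs about `H¹` (growth, radial limits, integrable maximal function) all follow from a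
factorization into two power series with `ℓ²` coefficients (`exists_eq_powSum_mul_powSum`) and an
`L²` maximal inequality (`lintegral_radialMax_powSum_le`). The latter linearizes the supremum by a
measurable radius `ρ(θ)` and bounds the operator `T : a ↦ ∑ a n (ρ(θ) e^{iθ})^n` by comparing the
kernel of `T T*` with Poisson kernels. -/

/-! ### Normalized measure on the circle and Bessel's inequality. -/

theorem circleMeasure_eq :
    circleMeasure = (ENNReal.ofReal (2 * Real.pi))⁻¹ • volume.restrict (Ioc 0 (2 * Real.pi)) := rfl

instance isProbabilityMeasure_circleMeasure : IsProbabilityMeasure circleMeasure := by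
  constructor
  have h : (0 : ℝ) < 2 * Real.pi := by positivity
  simp only [circleMeasure_eq, Measure.smul_apply, Measure.restrict_apply_univ, Real.volume_Ioc,
    sub_zero, smul_eq_mul]
  exact ENNReal.inv_mul_cancel (by simpa using h) ENNReal.ofReal_ne_top

theorem integral_circleMeasure {E : Type*} [NormedAddCommGroup E] [NormedSpace ℝ E] (f : ℝ → E) :
    ∫ θ, f θ ∂circleMeasure = (2 * Real.pi)⁻¹ • ∫ θ in 0..2 * Real.pi, f θ := by
  have h : (0 : ℝ) < 2 * Real.pi := by positivity
  rw [circleMeasure_eq, integral_smul_measure, intervalIntegral.integral_of_le h.le,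
    ENNReal.toReal_inv, ENNReal.toReal_ofReal h.le]

/-- Bessel's inequality for the nonnegative frequencies. -/
theorem bessel_circleMeasure {f : ℝ → ℂ} (hf : MemLp f 2 circleMeasure) :
    Summable (fun n : ℕ => ‖∫ θ, f θ * (starRingEnd ℂ (circleMap 0 1 θ)) ^ n ∂circleMeasure‖ ^ 2) ∧
      ∑' n : ℕ, ‖∫ θ, f θ * (starRingEnd ℂ (circleMap 0 1 θ)) ^ n ∂circleMeasure‖ ^ 2 ≤
        ∫ θ, ‖f θ‖ ^ 2 ∂circleMeasure := by
  have hπ : (0 : ℝ) < 2 * Real.pi := by positivity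
  have hf' : MemLp f 2 (volume.restrict (Ioc 0 (2 * Real.pi))) := by
    have hh : volume.restrict (Ioc 0 (2 * Real.pi)) =
        ENNReal.ofReal (2 * Real.pi) • circleMeasure := by
      rw [circleMeasure_eq, smul_smul, ENNReal.mul_inv_cancel (by simpa using hπ)
        ENNReal.ofReal_ne_top, one_smul]
    rw [hh]
    exact hf.smul_measure ENNReal.ofReal_ne_top
  have key := hasSum_sq_fourierCoeffOn hπ hf'
  have hco : ∀ n : ℕ, fourierCoeffOn hπ f n =
      ∫ θ, f θ * (starRingEnd ℂ (circleMap 0 1 θ)) ^ n ∂circleMeasure := by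
    intro n
    rw [fourierCoeffOn_eq_integral, integral_circleMeasure]
    simp only [sub_zero, one_div]
    congr 2
    ext x
    rw [fourier_coe_apply, smul_eq_mul, mul_comm]
    congr 1
    rw [circleMap, zero_add, Complex.ofReal_one, one_mul, ← Complex.exp_conj, ← Complex.exp_nat_mul]
    congr 1
    simp
    field_simp
  have hsum : HasSum (fun n : ℤ => ‖fourierCoeffOn hπ f n‖ ^ 2)
      (∫ θ, ‖f θ‖ ^ 2 ∂circleMeasure) := by
    rw [integral_circleMeasure]; simpa using key
  have hs := hsum.summable.comp_injective (Nat.cast_injective (R := ℤ))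
  have e : ((fun n : ℤ => ‖fourierCoeffOn hπ f n‖ ^ 2) ∘ (Nat.cast : ℕ → ℤ)) =
      fun n : ℕ => ‖∫ θ, f θ * (starRingEnd ℂ (circleMap 0 1 θ)) ^ n ∂circleMeasure‖ ^ 2 := by
    ext n; simp [hco]
  refine ⟨e ▸ hs, ?_⟩
  rw [← e, ← hsum.tsum_eq]
  exact tsum_comp_le_tsum_of_inj hsum.summable (fun _ => by positivity) Nat.cast_injective

/-! ### Moments, Cauchy kernels and comparison of Poisson kernels. -/

/-- Fubini and the geometric series turn `ℓ²` pairings of moment sequences into double integrals of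
a Cauchy kernel. The bound `r < 1` on one of the two points makes the interchange absolutely
convergent. -/
theorem hasSum_integral_mul_pow {α : Type*} [MeasurableSpace α] {μ : Measure α}
    [IsProbabilityMeasure μ] {f₁ f₂ z₁ z₂ : α → ℂ} {B r : ℝ} (hr : r < 1)
    (hf₁ : Measurable f₁) (hf₂ : Measurable f₂) (hz₁ : Measurable z₁) (hz₂ : Measurable z₂)
    (bf₁ : ∀ x, ‖f₁ x‖ ≤ B) (bf₂ : ∀ x, ‖f₂ x‖ ≤ B)
    (bz₁ : ∀ x, ‖z₁ x‖ ≤ r) (bz₂ : ∀ x, ‖z₂ x‖ ≤ 1) :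
    HasSum (fun n : ℕ => (∫ x, f₁ x * z₁ x ^ n ∂μ) * ∫ x, f₂ x * z₂ x ^ n ∂μ)
      (∫ p, f₁ p.1 * f₂ p.2 / (1 - z₁ p.1 * z₂ p.2) ∂μ.prod μ) := by
  have hne : Nonempty α := by
    by_contra h
    rw [not_nonempty_iff] at h
    have := measure_univ (μ := μ)
    simp [Measure.eq_zero_of_isEmpty μ] at this
  obtain ⟨x₀⟩ := hne
  have hB : 0 ≤ B := (norm_nonneg _).trans (bf₁ x₀)
  have hr0 : 0 ≤ r := (norm_nonneg _).trans (bz₁ x₀)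
  set F : ℕ → α × α → ℂ := fun n p => (f₁ p.1 * z₁ p.1 ^ n) * (f₂ p.2 * z₂ p.2 ^ n) with hF
  have bF : ∀ n p, ‖F n p‖ ≤ B * B * r ^ n := by
    intro n p
    simp only [hF, norm_mul, norm_pow]
    calc ‖f₁ p.1‖ * ‖z₁ p.1‖ ^ n * (‖f₂ p.2‖ * ‖z₂ p.2‖ ^ n)
        ≤ B * r ^ n * (B * 1 ^ n) := by
          gcongr
          exacts [bf₁ _, bz₁ _, bf₂ _, bz₂ _]
      _ = _ := by ring
  have hFi : ∀ n, Integrable (F n) (μ.prod μ) := by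
    intro n
    refine Integrable.of_bound (C := B * B * r ^ n) ?_ (ae_of_all _ (bF n))
    exact Measurable.aestronglyMeasurable (by fun_prop)
  have hs : Summable fun n => ∫ p, ‖F n p‖ ∂μ.prod μ := by
    refine Summable.of_nonneg_of_le (fun n => integral_nonneg fun _ => norm_nonneg _)
      (fun n => ?_) ((summable_geometric_of_lt_one hr0 hr).mul_left (B * B))
    calc ∫ p, ‖F n p‖ ∂μ.prod μ ≤ ∫ p, B * B * r ^ n ∂μ.prod μ :=
          integral_mono (hFi n).norm (integrable_const _) (bF n)
      _ = _ := by simp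
  have key := hasSum_integral_of_summable_integral_norm hFi hs
  have e1 : ∀ n, ∫ p, F n p ∂μ.prod μ = (∫ x, f₁ x * z₁ x ^ n ∂μ) * ∫ x, f₂ x * z₂ x ^ n ∂μ :=
    fun n => integral_prod_mul (fun x => f₁ x * z₁ x ^ n) (fun x => f₂ x * z₂ x ^ n)
  simp only [e1] at key
  have e2 : ∀ p, f₁ p.1 * f₂ p.2 / (1 - z₁ p.1 * z₂ p.2) = ∑' n, F n p := fun p => by
    have hlt : ‖z₁ p.1 * z₂ p.2‖ < 1 := by
      rw [norm_mul]
      calc _ ≤ r * 1 := mul_le_mul (bz₁ _) (bz₂ _) (norm_nonneg _) hr0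
        _ < 1 := by linarith
    have := (hasSum_geometric_of_norm_lt_one hlt).mul_left (f₁ p.1 * f₂ p.2)
    simp only [hF, div_eq_mul_inv]
    rw [← this.tsum_eq]
    refine tsum_congr fun n => ?_
    rw [mul_pow]; ring
  simpa only [e2] using key

/-- The real part of the Cauchy kernel is half the Poisson kernel plus `1/2`, so on the disc it is
positive and can be compared pointwise. -/
theorem re_one_div_one_sub {w : ℂ} (hw : w ≠ 1) :
    (1 / (1 - w)).re = (1 - ‖w‖ ^ 2) / (2 * ‖1 - w‖ ^ 2) + 1 / 2 := by
  have h1 : (1 - w) ≠ 0 := sub_ne_zero.mpr hw.symm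
  have h2 : ‖1 - w‖ ^ 2 ≠ 0 := by positivity
  rw [one_div, Complex.inv_re, Complex.normSq_eq_norm_sq]
  field_simp
  rw [← Complex.normSq_eq_norm_sq, ← Complex.normSq_eq_norm_sq]
  simp only [Complex.normSq_apply, Complex.sub_re, Complex.one_re, Complex.sub_im, Complex.one_im]
  ring

theorem half_le_re_one_div_one_sub {w : ℂ} (hw : ‖w‖ < 1) : 1 / 2 ≤ (1 / (1 - w)).re := by
  have h : w ≠ 1 := by rintro rfl; simp at hw
  rw [re_one_div_one_sub h]
  have : 0 ≤ (1 - ‖w‖ ^ 2) / (2 * ‖1 - w‖ ^ 2) := by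
    apply div_nonneg _ (by positivity)
    nlinarith [norm_nonneg w]
  linarith

theorem poisson_compare_aux {u : ℂ} (hu : ‖u‖ = 1) {r s : ℝ} (hr : 0 ≤ r) (hrs : r ≤ s)
    (hs : s < 1) : (1 / (1 - r * s * u)).re ≤ 8 * (1 / (1 - r * u)).re := by
  have n1 : ‖(r * u : ℂ)‖ = r := by simp [hu, abs_of_nonneg hr]
  have n2 : ‖(r * s * u : ℂ)‖ = r * s := by
    simp [hu, abs_of_nonneg hr, abs_of_nonneg (hr.trans hrs)]
  have hrs' : r * s ≤ r := by nlinarith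
  have d1 : (r * u : ℂ) ≠ 1 := fun h => by rw [h] at n1; simp at n1; linarith
  have d2 : (r * s * u : ℂ) ≠ 1 := fun h => by rw [h] at n2; simp at n2; linarith
  rw [re_one_div_one_sub d1, re_one_div_one_sub d2, n1, n2]
  have p1 : 0 < ‖1 - (r * u : ℂ)‖ := norm_pos_iff.2 (sub_ne_zero.2 d1.symm)
  have p2 : 0 < ‖1 - (r * s * u : ℂ)‖ := norm_pos_iff.2 (sub_ne_zero.2 d2.symm)
  -- The two points are `r(1 - s)` apart, and `r(1 - s) ≤ 1 - rs ≤ |1 - rsu|`.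
  have k1 : ‖1 - (r * u : ℂ)‖ ≤ 2 * ‖1 - (r * s * u : ℂ)‖ := by
    have a : ‖1 - (r * u : ℂ)‖ ≤ ‖1 - (r * s * u : ℂ)‖ + ‖(r * s * u - r * u : ℂ)‖ := by
      refine le_trans (le_of_eq ?_) (norm_add_le _ _)
      congr 1; ring
    have b : ‖(r * s * u - r * u : ℂ)‖ = r * (1 - s) := by
      have : (r * s * u - r * u : ℂ) = -((r * (1 - s) : ℝ) * u) := by push_cast; ring
      rw [this, norm_neg, norm_mul, hu, Complex.norm_real, mul_one, Real.norm_eq_abs, abs_of_nonneg]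
      exact mul_nonneg hr (by linarith)
    have c : 1 - r * s ≤ ‖1 - (r * s * u : ℂ)‖ := by
      have := norm_sub_norm_le (1 : ℂ) (r * s * u)
      rwa [norm_one, n2] at this
    nlinarith
  -- Here `r ≤ s` enters: `rs ≥ r²`, hence `1 - (rs)² ≤ (1 - r²)(1 + r²)`. Together with the square
  -- of `k1` this yields the constant `2 · 4 = 8`.
  have k2 : 1 - (r * s) ^ 2 ≤ 2 * (1 - r ^ 2) := by nlinarith
  have k3 : (1 - (r * s) ^ 2) / (2 * ‖1 - (r * s * u : ℂ)‖ ^ 2) ≤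
      8 * ((1 - r ^ 2) / (2 * ‖1 - (r * u : ℂ)‖ ^ 2)) := by
    rw [← mul_div_assoc, div_le_div_iff₀ (by positivity) (by positivity)]
    have k4 : ‖1 - (r * u : ℂ)‖ ^ 2 ≤ 4 * ‖1 - (r * s * u : ℂ)‖ ^ 2 := by nlinarith
    calc (1 - (r * s) ^ 2) * (2 * ‖1 - (r * u : ℂ)‖ ^ 2)
        ≤ (2 * (1 - r ^ 2)) * (2 * (4 * ‖1 - (r * s * u : ℂ)‖ ^ 2)) := by
          have : 0 ≤ 1 - r ^ 2 := by nlinarith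
          gcongr
      _ = _ := by ring
  linarith

/-- The kernel of `T T*` is dominated by the sum of the kernels of `T` and `T*`. -/
theorem poisson_compare {z w : ℂ} (hz : ‖z‖ = 1) (hw : ‖w‖ = 1) {r s : ℝ} (hr : 0 ≤ r) (hr1 : r < 1)
    (hs : 0 ≤ s) (hs1 : s < 1) :
    (1 / (1 - (r * z) * starRingEnd ℂ (s * w))).re ≤
      8 * ((1 / (1 - (r * z) * starRingEnd ℂ w)).re + (1 / (1 - (s * w) * starRingEnd ℂ z)).re) := by
  have hu : ‖z * starRingEnd ℂ w‖ = 1 := by simp [hz, hw]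
  have hu' : ‖w * starRingEnd ℂ z‖ = 1 := by simp [hz, hw]
  have p1 : 1 / 2 ≤ (1 / (1 - (r * z) * starRingEnd ℂ w)).re := by
    apply half_le_re_one_div_one_sub; simp [hz, hw, abs_of_nonneg hr, hr1]
  have p2 : 1 / 2 ≤ (1 / (1 - (s * w) * starRingEnd ℂ z)).re := by
    apply half_le_re_one_div_one_sub; simp [hz, hw, abs_of_nonneg hs, hs1]
  rcases le_total r s with h | h
  · have := poisson_compare_aux hu hr h hs1
    rw [show (r * s * (z * starRingEnd ℂ w) : ℂ) = (r * z) * starRingEnd ℂ (s * w) by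
      simp; ring, ← mul_assoc] at this
    linarith
  · have := poisson_compare_aux hu' hs h hr1
    have e : (1 / (1 - s * r * (w * starRingEnd ℂ z)) : ℂ) =
        starRingEnd ℂ (1 / (1 - (r * z) * starRingEnd ℂ (s * w))) := by
      simp; ring
    rw [e, Complex.conj_re, ← mul_assoc] at this
    linarith

theorem integrable_mul_div_one_sub {α : Type*} [MeasurableSpace α] {μ : Measure α}
    [IsFiniteMeasure μ] {ψ : α → ℝ} {z w : α → ℂ} {B r : ℝ} (hr : r < 1)
    (hψ : Measurable ψ) (hz : Measurable z) (hw : Measurable w)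
    (bψ : ∀ x, |ψ x| ≤ B) (bz : ∀ x, ‖z x‖ ≤ r) (bw : ∀ x, ‖w x‖ ≤ 1) :
    Integrable (fun p : α × α => (ψ p.1 : ℂ) * ψ p.2 / (1 - z p.1 * w p.2)) (μ.prod μ) := by
  refine Integrable.of_bound (C := B * B / (1 - r))
    (Measurable.aestronglyMeasurable (by fun_prop)) (ae_of_all _ fun p => ?_)
  have hB : 0 ≤ B := (abs_nonneg _).trans (bψ p.1)
  have hr0 : 0 ≤ r := (norm_nonneg _).trans (bz p.1)
  rw [norm_div, norm_mul, Complex.norm_real, Complex.norm_real]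
  have h1 : 1 - r ≤ ‖1 - z p.1 * w p.2‖ := by
    have h2 := norm_sub_norm_le (1 : ℂ) (z p.1 * w p.2)
    have h3 : ‖z p.1 * w p.2‖ ≤ r * 1 := by
      rw [norm_mul]
      exact mul_le_mul (bz _) (bw _) (norm_nonneg _) hr0
    rw [norm_one] at h2
    linarith
  have h4 : 0 < 1 - r := by linarith
  exact div_le_div₀ (by positivity) (mul_le_mul (bψ _) (bψ _) (abs_nonneg _) hB) h4 h1

theorem re_mul_div_one_sub (a b : ℝ) (w : ℂ) :
    ((a : ℂ) * b / (1 - w)).re = a * b * (1 / (1 - w)).re := by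
  rw [← Complex.ofReal_mul, div_eq_mul_one_div, Complex.re_ofReal_mul]

/-! ### The linearized maximal operator: bound for its adjoint. -/

section LinearizedMaximal

variable {ρ : ℝ → ℝ} {r : ℝ}

theorem norm_ofReal_mul_circleMap (s θ : ℝ) : ‖(s : ℂ) * circleMap 0 1 θ‖ = |s| := by
  simp [circleMap, Complex.norm_exp_ofReal_mul_I]

/-- This is `‖T*ψ‖² = ⟨T T*ψ, ψ⟩`. For real `ψ` the conjugated moments are the conjugates of the
moments, and only the real part of the kernel matters. -/
theorem hasSum_normSq_of_real (hr : r < 1) (hρ : Measurable ρ) (hρ0 : ∀ θ, 0 ≤ ρ θ)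
    (hρr : ∀ θ, ρ θ ≤ r) {ψ : ℝ → ℝ} {B : ℝ} (hψ : Measurable ψ) (bψ : ∀ x, |ψ x| ≤ B) :
    HasSum (fun n : ℕ => ‖∫ θ, (ψ θ : ℂ) * (ρ θ * circleMap 0 1 θ) ^ n ∂circleMeasure‖ ^ 2)
      (∫ p, ψ p.1 * ψ p.2 * (1 / (1 - (ρ p.1 * circleMap 0 1 p.1) *
        starRingEnd ℂ (ρ p.2 * circleMap 0 1 p.2))).re ∂circleMeasure.prod circleMeasure) := by
  have hz : Measurable fun θ : ℝ => (ρ θ * circleMap 0 1 θ : ℂ) := by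
    have := (continuous_circleMap 0 1).measurable
    fun_prop
  have hz' : Measurable fun θ : ℝ => starRingEnd ℂ (ρ θ * circleMap 0 1 θ : ℂ) :=
    Complex.continuous_conj.measurable.comp hz
  have bz : ∀ θ, ‖(ρ θ * circleMap 0 1 θ : ℂ)‖ ≤ r := fun θ => by
    rw [norm_ofReal_mul_circleMap, abs_of_nonneg (hρ0 θ)]; exact hρr θ
  have bz' : ∀ θ, ‖starRingEnd ℂ (ρ θ * circleMap 0 1 θ : ℂ)‖ ≤ 1 := fun θ => by
    rw [RCLike.norm_conj]; exact (bz θ).trans hr.le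
  have bψ' : ∀ θ, ‖(ψ θ : ℂ)‖ ≤ B := fun θ => by simpa using bψ θ
  have key := hasSum_integral_mul_pow (μ := circleMeasure) hr (f₁ := fun θ => (ψ θ : ℂ))
    (f₂ := fun θ => (ψ θ : ℂ)) (by fun_prop) (by fun_prop) hz hz' bψ' bψ' bz bz'
  have key2 := (Complex.hasSum_re key)
  have hi := integrable_mul_div_one_sub (μ := circleMeasure) hr hψ hz hz' bψ bz bz'
  have e : (∫ p, (ψ p.1 : ℂ) * ψ p.2 / (1 - (ρ p.1 * circleMap 0 1 p.1) *
        starRingEnd ℂ (ρ p.2 * circleMap 0 1 p.2)) ∂circleMeasure.prod circleMeasure).re =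
      ∫ p, ψ p.1 * ψ p.2 * (1 / (1 - (ρ p.1 * circleMap 0 1 p.1) *
        starRingEnd ℂ (ρ p.2 * circleMap 0 1 p.2))).re ∂circleMeasure.prod circleMeasure := by
    have h := integral_re hi
    simp only [RCLike.re_to_complex] at h
    rw [← h]
    simp only [re_mul_div_one_sub]
  rw [e] at key2
  refine key2.congr_fun fun n => ?_
  have hc : ∫ θ, (ψ θ : ℂ) * (starRingEnd ℂ (ρ θ * circleMap 0 1 θ)) ^ n ∂circleMeasure =
      starRingEnd ℂ (∫ θ, (ψ θ : ℂ) * (ρ θ * circleMap 0 1 θ) ^ n ∂circleMeasure) := by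
    rw [← integral_conj]
    simp
  rw [hc, Complex.mul_conj, Complex.normSq_eq_norm_sq, Complex.ofReal_re]

/-- The dual form of the `L²` maximal inequality, for nonnegative functions. -/
theorem tsum_normSq_le_of_nonneg (hr : r < 1) (hρ : Measurable ρ) (hρ0 : ∀ θ, 0 ≤ ρ θ)
    (hρr : ∀ θ, ρ θ ≤ r) {ψ : ℝ → ℝ} {B : ℝ} (hψ : Measurable ψ) (hψ0 : ∀ x, 0 ≤ ψ x)
    (bψ : ∀ x, |ψ x| ≤ B) :
    ∑' n : ℕ, ‖∫ θ, (ψ θ : ℂ) * (ρ θ * circleMap 0 1 θ) ^ n ∂circleMeasure‖ ^ 2 ≤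
      256 * ∫ θ, ψ θ ^ 2 ∂circleMeasure := by
  have hζ : Measurable fun θ : ℝ => (circleMap 0 1 θ : ℂ) := (continuous_circleMap 0 1).measurable
  have hz : Measurable fun θ : ℝ => (ρ θ * circleMap 0 1 θ : ℂ) := by fun_prop
  have hz' : Measurable fun θ : ℝ => starRingEnd ℂ (ρ θ * circleMap 0 1 θ : ℂ) :=
    Complex.continuous_conj.measurable.comp hz
  have hζ' : Measurable fun θ : ℝ => starRingEnd ℂ (circleMap 0 1 θ : ℂ) :=
    Complex.continuous_conj.measurable.comp hζ
  have bz : ∀ θ, ‖(ρ θ * circleMap 0 1 θ : ℂ)‖ ≤ r := fun θ => by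
    rw [norm_ofReal_mul_circleMap, abs_of_nonneg (hρ0 θ)]; exact hρr θ
  have bz' : ∀ θ, ‖starRingEnd ℂ (ρ θ * circleMap 0 1 θ : ℂ)‖ ≤ 1 := fun θ => by
    rw [RCLike.norm_conj]; exact (bz θ).trans hr.le
  have nζ : ∀ θ, ‖(circleMap 0 1 θ : ℂ)‖ = 1 := fun θ => by simp
  have bζ' : ∀ θ, ‖starRingEnd ℂ (circleMap 0 1 θ : ℂ)‖ ≤ 1 := fun θ => by
    rw [RCLike.norm_conj, nζ]
  have bψ' : ∀ θ, ‖(ψ θ : ℂ)‖ ≤ B := fun θ => by simpa using bψ θ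
  have E1 := hasSum_normSq_of_real hr hρ hρ0 hρr hψ bψ
  have D1 := Complex.hasSum_re (hasSum_integral_mul_pow (μ := circleMeasure) hr
    (f₁ := fun θ => (ψ θ : ℂ)) (f₂ := fun θ => (ψ θ : ℂ)) (by fun_prop) (by fun_prop) hz hζ'
    bψ' bψ' bz bζ')
  have iE := (integrable_mul_div_one_sub (μ := circleMeasure) hr hψ hz hz' bψ bz bz').re
  have iD := (integrable_mul_div_one_sub (μ := circleMeasure) hr hψ hz hζ' bψ bz bζ')
  have eD : (∫ p, (ψ p.1 : ℂ) * ψ p.2 / (1 - (ρ p.1 * circleMap 0 1 p.1) *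
        starRingEnd ℂ (circleMap 0 1 p.2)) ∂circleMeasure.prod circleMeasure).re =
      ∫ p, ψ p.1 * ψ p.2 * (1 / (1 - (ρ p.1 * circleMap 0 1 p.1) *
        starRingEnd ℂ (circleMap 0 1 p.2))).re ∂circleMeasure.prod circleMeasure := by
    have h := integral_re iD
    simp only [RCLike.re_to_complex] at h
    rw [← h]
    simp only [re_mul_div_one_sub]
  rw [eD] at D1
  replace iD := iD.re
  simp only [RCLike.re_to_complex, re_mul_div_one_sub] at iE iD
  set K := ∫ p, ψ p.1 * ψ p.2 * (1 / (1 - (ρ p.1 * circleMap 0 1 p.1) *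
        starRingEnd ℂ (ρ p.2 * circleMap 0 1 p.2))).re ∂circleMeasure.prod circleMeasure with hK
  set D := ∫ p, ψ p.1 * ψ p.2 * (1 / (1 - (ρ p.1 * circleMap 0 1 p.1) *
        starRingEnd ℂ (circleMap 0 1 p.2))).re ∂circleMeasure.prod circleMeasure with hD
  -- Integrate `poisson_compare` against `ψ(θ)ψ(θ')`, which is nonnegative; the two kernels on its
  -- right are exchanged by swapping the variables, so each contributes `8 D`.
  have hKD : K ≤ 16 * D := by
    have hsw : ∫ p, ψ p.2 * ψ p.1 * (1 / (1 - (ρ p.2 * circleMap 0 1 p.2) *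
        starRingEnd ℂ (circleMap 0 1 p.1))).re ∂circleMeasure.prod circleMeasure = D :=
      integral_prod_swap (μ := circleMeasure) (ν := circleMeasure)
        (fun p : ℝ × ℝ => ψ p.1 * ψ p.2 * (1 / (1 - (ρ p.1 * circleMap 0 1 p.1) *
        starRingEnd ℂ (circleMap 0 1 p.2))).re)
    have isw : Integrable (fun p : ℝ × ℝ => ψ p.2 * ψ p.1 * (1 / (1 - (ρ p.2 * circleMap 0 1 p.2) *
        starRingEnd ℂ (circleMap 0 1 p.1))).re) (circleMeasure.prod circleMeasure) := iD.swap
    have : K ≤ ∫ p, (8 * (ψ p.1 * ψ p.2 * (1 / (1 - (ρ p.1 * circleMap 0 1 p.1) *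
        starRingEnd ℂ (circleMap 0 1 p.2))).re) + 8 * (ψ p.2 * ψ p.1 *
        (1 / (1 - (ρ p.2 * circleMap 0 1 p.2) *
        starRingEnd ℂ (circleMap 0 1 p.1))).re)) ∂circleMeasure.prod circleMeasure := by
      refine integral_mono iE ((iD.const_mul 8).add (isw.const_mul 8)) fun p => ?_
      have := poisson_compare (nζ p.1) (nζ p.2) (hρ0 p.1) ((hρr p.1).trans_lt hr) (hρ0 p.2)
        ((hρr p.2).trans_lt hr)
      have h0 : 0 ≤ ψ p.1 * ψ p.2 := mul_nonneg (hψ0 _) (hψ0 _)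
      have := mul_le_mul_of_nonneg_left this h0
      simp only
      linarith
    rw [integral_add (iD.const_mul 8) (isw.const_mul 8), integral_const_mul, integral_const_mul,
      hsw] at this
    linarith
  have hψ2 : MemLp (fun θ => (ψ θ : ℂ)) 2 circleMeasure :=
    MemLp.of_bound (Measurable.aestronglyMeasurable (by fun_prop)) B (ae_of_all _ bψ')
  obtain ⟨sB, leB⟩ := bessel_circleMeasure hψ2
  -- `D` pairs the moments of `ψ` along `ρ` with its Fourier coefficients. The weights in `xy ≤
  -- x²/32 + 8y²` make `16 D ≤ K/2 + 128 ∫ ψ²`, so that half of `K` can be absorbed.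
  have hDle : D ≤ K / 32 + 8 * ∫ θ, ψ θ ^ 2 ∂circleMeasure := by
    have h1 : D ≤ K / 32 + 8 * ∑' n : ℕ,
        ‖∫ θ, (ψ θ : ℂ) * (starRingEnd ℂ (circleMap 0 1 θ)) ^ n ∂circleMeasure‖ ^ 2 := by
      refine hasSum_le (fun n => ?_) D1 ((E1.div_const 32).add (sB.hasSum.mul_left 8))
      refine (Complex.re_le_norm _).trans ?_
      rw [norm_mul]
      nlinarith [sq_nonneg (‖∫ θ, (ψ θ : ℂ) * (ρ θ * circleMap 0 1 θ) ^ n ∂circleMeasure‖ - 16 *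
        ‖∫ θ, (ψ θ : ℂ) * (starRingEnd ℂ (circleMap 0 1 θ)) ^ n ∂circleMeasure‖)]
    have h2 : ∫ θ, ‖(ψ θ : ℂ)‖ ^ 2 ∂circleMeasure = ∫ θ, ψ θ ^ 2 ∂circleMeasure := by simp
    rw [h2] at leB
    linarith
  rw [E1.tsum_eq]
  linarith

/-- Because the real part of the kernel is positive, replacing `ψ` by `|ψ|` only increases the
quadratic form. -/
theorem tsum_normSq_le_of_real (hr : r < 1) (hρ : Measurable ρ) (hρ0 : ∀ θ, 0 ≤ ρ θ)
    (hρr : ∀ θ, ρ θ ≤ r) {ψ : ℝ → ℝ} {B : ℝ} (hψ : Measurable ψ) (bψ : ∀ x, |ψ x| ≤ B) :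
    ∑' n : ℕ, ‖∫ θ, (ψ θ : ℂ) * (ρ θ * circleMap 0 1 θ) ^ n ∂circleMeasure‖ ^ 2 ≤
      256 * ∫ θ, ψ θ ^ 2 ∂circleMeasure := by
  have hψa : Measurable fun x => |ψ x| := hψ.abs
  have bψa : ∀ x, |(|ψ x|)| ≤ B := fun x => by rw [abs_abs]; exact bψ x
  have E1 := hasSum_normSq_of_real hr hρ hρ0 hρr hψ bψ
  have E2 := hasSum_normSq_of_real hr hρ hρ0 hρr hψa bψa
  have h := tsum_normSq_le_of_nonneg hr hρ hρ0 hρr hψa (fun x => abs_nonneg _) bψa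
  have hz : Measurable fun θ : ℝ => (ρ θ * circleMap 0 1 θ : ℂ) := by
    have := (continuous_circleMap 0 1).measurable
    fun_prop
  have hz' : Measurable fun θ : ℝ => starRingEnd ℂ (ρ θ * circleMap 0 1 θ : ℂ) :=
    Complex.continuous_conj.measurable.comp hz
  have bz : ∀ θ, ‖(ρ θ * circleMap 0 1 θ : ℂ)‖ ≤ r := fun θ => by
    rw [norm_ofReal_mul_circleMap, abs_of_nonneg (hρ0 θ)]; exact hρr θ
  have bz' : ∀ θ, ‖starRingEnd ℂ (ρ θ * circleMap 0 1 θ : ℂ)‖ ≤ 1 := fun θ => by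
    rw [RCLike.norm_conj]; exact (bz θ).trans hr.le
  have i1 := (integrable_mul_div_one_sub (μ := circleMeasure) hr hψ hz hz' bψ bz bz').re
  have i2 := (integrable_mul_div_one_sub (μ := circleMeasure) hr hψa hz hz' bψa bz bz').re
  simp only [RCLike.re_to_complex, re_mul_div_one_sub] at i1 i2
  simp only [sq_abs] at h
  refine le_trans ?_ h
  rw [E1.tsum_eq, E2.tsum_eq]
  refine integral_mono i1 i2 fun p => ?_
  refine mul_le_mul_of_nonneg_right ?_ ?_
  · rw [← abs_mul]; exact le_abs_self _
  · refine le_trans (by norm_num) (half_le_re_one_div_one_sub ?_)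
    rw [norm_mul]
    calc _ ≤ r * 1 := mul_le_mul (bz _) (bz' _) (norm_nonneg _) ((norm_nonneg _).trans (bz p.1))
      _ < 1 := by linarith

/-- Splitting into real and imaginary parts costs the factor `2` in `|x + iy|² ≤ 2|x|² + 2|y|²`. -/
theorem tsum_normSq_le (hr : r < 1) (hρ : Measurable ρ) (hρ0 : ∀ θ, 0 ≤ ρ θ)
    (hρr : ∀ θ, ρ θ ≤ r) {ψ : ℝ → ℂ} {B : ℝ} (hψ : Measurable ψ) (bψ : ∀ x, ‖ψ x‖ ≤ B) :
    Summable (fun n : ℕ => ‖∫ θ, ψ θ * (ρ θ * circleMap 0 1 θ) ^ n ∂circleMeasure‖ ^ 2) ∧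
    ∑' n : ℕ, ‖∫ θ, ψ θ * (ρ θ * circleMap 0 1 θ) ^ n ∂circleMeasure‖ ^ 2 ≤
      512 * ∫ θ, ‖ψ θ‖ ^ 2 ∂circleMeasure := by
  have m1 : Measurable fun x => (ψ x).re := Complex.measurable_re.comp hψ
  have m2 : Measurable fun x => (ψ x).im := Complex.measurable_im.comp hψ
  have b1 : ∀ x, |(ψ x).re| ≤ B := fun x => (Complex.abs_re_le_norm _).trans (bψ x)
  have b2 : ∀ x, |(ψ x).im| ≤ B := fun x => (Complex.abs_im_le_norm _).trans (bψ x)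
  have hz : Measurable fun θ : ℝ => (ρ θ * circleMap 0 1 θ : ℂ) := by
    have := (continuous_circleMap 0 1).measurable
    fun_prop
  have bz : ∀ θ, ‖(ρ θ * circleMap 0 1 θ : ℂ)‖ ≤ 1 := fun θ => by
    rw [norm_ofReal_mul_circleMap, abs_of_nonneg (hρ0 θ)]; exact (hρr θ).trans hr.le
  have E1 := (hasSum_normSq_of_real hr hρ hρ0 hρr m1 b1).summable
  have E2 := (hasSum_normSq_of_real hr hρ hρ0 hρr m2 b2).summable
  have h1 := tsum_normSq_le_of_real hr hρ hρ0 hρr m1 b1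
  have h2 := tsum_normSq_le_of_real hr hρ hρ0 hρr m2 b2
  have hi : ∀ f : ℝ → ℝ, Measurable f → (∀ x, |f x| ≤ B) → ∀ n : ℕ,
      Integrable (fun θ => (f θ : ℂ) * (ρ θ * circleMap 0 1 θ) ^ n) circleMeasure := by
    intro f mf bf n
    refine Integrable.of_bound (C := B * 1) (Measurable.aestronglyMeasurable (by fun_prop))
      (ae_of_all _ fun θ => ?_)
    rw [norm_mul, norm_pow, Complex.norm_real]
    exact mul_le_mul (bf _) (pow_le_one₀ (norm_nonneg _) (bz _)) (by positivity)
      ((abs_nonneg _).trans (bf θ))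
  have hle : ∀ n : ℕ, ‖∫ θ, ψ θ * (ρ θ * circleMap 0 1 θ) ^ n ∂circleMeasure‖ ^ 2 ≤
      2 * ‖∫ θ, ((ψ θ).re : ℂ) * (ρ θ * circleMap 0 1 θ) ^ n ∂circleMeasure‖ ^ 2 +
      2 * ‖∫ θ, ((ψ θ).im : ℂ) * (ρ θ * circleMap 0 1 θ) ^ n ∂circleMeasure‖ ^ 2 := by
    intro n
    have : ∫ θ, ψ θ * (ρ θ * circleMap 0 1 θ) ^ n ∂circleMeasure =
        (∫ θ, ((ψ θ).re : ℂ) * (ρ θ * circleMap 0 1 θ) ^ n ∂circleMeasure) +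
        Complex.I * ∫ θ, ((ψ θ).im : ℂ) * (ρ θ * circleMap 0 1 θ) ^ n ∂circleMeasure := by
      rw [← integral_const_mul, ← integral_add (hi _ m1 b1 n) ((hi _ m2 b2 n).const_mul _)]
      congr 1
      ext θ
      conv_lhs => rw [← Complex.re_add_im (ψ θ)]
      ring
    rw [this]
    have hn := norm_add_le (∫ θ, ((ψ θ).re : ℂ) * (ρ θ * circleMap 0 1 θ) ^ n ∂circleMeasure)
      (Complex.I * ∫ θ, ((ψ θ).im : ℂ) * (ρ θ * circleMap 0 1 θ) ^ n ∂circleMeasure)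
    rw [norm_mul, Complex.norm_I, one_mul] at hn
    refine (pow_le_pow_left₀ (norm_nonneg _) hn 2).trans ?_
    nlinarith [sq_nonneg (‖∫ θ, ((ψ θ).re : ℂ) * (ρ θ * circleMap 0 1 θ) ^ n ∂circleMeasure‖ -
      ‖∫ θ, ((ψ θ).im : ℂ) * (ρ θ * circleMap 0 1 θ) ^ n ∂circleMeasure‖)]
  have hS := Summable.of_nonneg_of_le (fun n => by positivity) hle
    ((E1.mul_left 2).add (E2.mul_left 2))
  refine ⟨hS, (hS.tsum_le_tsum hle ((E1.mul_left 2).add (E2.mul_left 2))).trans ?_⟩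
  rw [(E1.mul_left 2).tsum_add (E2.mul_left 2), tsum_mul_left, tsum_mul_left]
  have hi2 : ∀ f : ℝ → ℝ, Measurable f → (∀ x, |f x| ≤ B) →
      Integrable (fun θ => f θ ^ 2) circleMeasure := by
    intro f mf bf
    refine Integrable.of_bound (C := B ^ 2) (Measurable.aestronglyMeasurable (by fun_prop))
      (ae_of_all _ fun θ => ?_)
    rw [norm_pow]
    exact pow_le_pow_left₀ (norm_nonneg _) (bf θ) 2
  have : ∫ θ, ‖ψ θ‖ ^ 2 ∂circleMeasure =
      (∫ θ, (ψ θ).re ^ 2 ∂circleMeasure) + ∫ θ, (ψ θ).im ^ 2 ∂circleMeasure := by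
    rw [← integral_add (hi2 _ m1 b1) (hi2 _ m2 b2)]
    congr 1
    ext θ
    rw [← Complex.normSq_eq_norm_sq, Complex.normSq_apply]; ring
  rw [this]
  linarith

end LinearizedMaximal

/-! ### Power series with square summable coefficients. -/

/-- The sum of the power series with coefficients `a`. -/
noncomputable def powSum (a : ℕ → ℂ) (z : ℂ) : ℂ := ∑' n, a n * z ^ n

theorem norm_mul_pow_le (c z : ℂ) {t : ℝ} (ht : 0 < t) (n : ℕ) :
    ‖c * z ^ n‖ ≤ t / 2 * ‖c‖ ^ 2 + 1 / (2 * t) * (‖z‖ ^ 2) ^ n := by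
  rw [norm_mul, norm_pow, ← pow_mul, mul_comm 2 n, pow_mul]
  have h : 0 ≤ (t * ‖c‖ - ‖z‖ ^ n) ^ 2 / (2 * t) := by positivity
  have e : (t * ‖c‖ - ‖z‖ ^ n) ^ 2 / (2 * t) =
      t / 2 * ‖c‖ ^ 2 + 1 / (2 * t) * (‖z‖ ^ n) ^ 2 - ‖c‖ * ‖z‖ ^ n := by
    field_simp; ring
  linarith

theorem summable_norm_mul_pow {a : ℕ → ℂ} (ha : Summable fun n => ‖a n‖ ^ 2) {z : ℂ} (hz : ‖z‖ < 1) :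
    Summable fun n => ‖a n * z ^ n‖ := by
  have h1 : ‖z‖ ^ 2 < 1 := by nlinarith [norm_nonneg z]
  exact Summable.of_nonneg_of_le (fun _ => norm_nonneg _)
    (fun n => norm_mul_pow_le (a n) z one_pos n)
    ((ha.mul_left _).add ((summable_geometric_of_lt_one (by positivity) h1).mul_left _))

theorem hasSum_powSum {a : ℕ → ℂ} (ha : Summable fun n => ‖a n‖ ^ 2) {z : ℂ} (hz : ‖z‖ < 1) :
    HasSum (fun n => a n * z ^ n) (powSum a z) :=
  (summable_norm_mul_pow ha hz).of_norm.hasSum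

/-- Cauchy–Schwarz in the weighted form of `norm_mul_pow_le`, with `t = (1 - |z|²)^(-1/2)`. Only the
exponent `1/2` matters: two such factors give growth `A/(1 - |z|²)`. -/
theorem norm_powSum_le {a : ℕ → ℂ} (ha : Summable fun n => ‖a n‖ ^ 2) {z : ℂ} (hz : ‖z‖ < 1) :
    ‖powSum a z‖ ≤ (∑' n, ‖a n‖ ^ 2 + 1) / √(1 - ‖z‖ ^ 2) := by
  have h1 : ‖z‖ ^ 2 < 1 := by nlinarith [norm_nonneg z]
  set t : ℝ := 1 / √(1 - ‖z‖ ^ 2) with ht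
  have hs : 0 < √(1 - ‖z‖ ^ 2) := Real.sqrt_pos.2 (by linarith)
  have hss : √(1 - ‖z‖ ^ 2) ^ 2 = 1 - ‖z‖ ^ 2 := Real.sq_sqrt (by linarith)
  have ht0 : 0 < t := by positivity
  have hg := summable_geometric_of_lt_one (by positivity) h1
  have hR := (ha.mul_left (t / 2)).add (hg.mul_left (1 / (2 * t)))
  have h2 : ‖powSum a z‖ ≤ ∑' n, (t / 2 * ‖a n‖ ^ 2 + 1 / (2 * t) * (‖z‖ ^ 2) ^ n) :=
    (norm_tsum_le_tsum_norm (summable_norm_mul_pow ha hz)).trans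
      ((summable_norm_mul_pow ha hz).tsum_le_tsum (fun n => norm_mul_pow_le (a n) z ht0 n) hR)
  rw [(ha.mul_left (t / 2)).tsum_add (hg.mul_left (1 / (2 * t))), tsum_mul_left, tsum_mul_left,
    tsum_geometric_of_lt_one (by positivity) h1] at h2
  refine h2.trans ?_
  have h3 : 0 ≤ ∑' n, ‖a n‖ ^ 2 := tsum_nonneg fun _ => by positivity
  generalize √(1 - ‖z‖ ^ 2) = s at *
  rw [← hss, ht]
  have : 1 / s / 2 * ∑' n, ‖a n‖ ^ 2 + 1 / (2 * (1 / s)) * (s ^ 2)⁻¹ =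
    (∑' n, ‖a n‖ ^ 2 + 1) / s / 2 := by field_simp
  rw [this]
  have : 0 ≤ (∑' n, ‖a n‖ ^ 2 + 1) / s := by positivity
  linarith

theorem differentiableOn_powSum {a : ℕ → ℂ} (ha : Summable fun n => ‖a n‖ ^ 2) :
    DifferentiableOn ℂ (powSum a) disc := by
  intro z hz
  have hz1 : ‖z‖ < 1 := by simpa [disc] using hz
  obtain ⟨s, hs1, hs2⟩ := exists_between hz1
  have hs0 : 0 < s := (norm_nonneg z).trans_lt hs1
  have hsum := summable_norm_mul_pow ha (z := (s : ℂ))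
    (by rwa [Complex.norm_real, Real.norm_of_nonneg hs0.le])
  have := Complex.differentiableOn_tsum_of_summable_norm (F := fun n z => a n * z ^ n) hsum
    (fun n => by fun_prop) (Metric.isOpen_ball (x := (0 : ℂ)) (ε := s)) (fun n w hw => by
      have hw' : ‖w‖ < s := by simpa using hw
      rw [norm_mul, norm_mul, norm_pow, norm_pow, Complex.norm_real, Real.norm_of_nonneg hs0.le]
      gcongr)
  exact (this.differentiableAt (Metric.isOpen_ball.mem_nhds (by simpa using hs1))).differentiableWithinAt

theorem continuousOn_powSum {a : ℕ → ℂ} (ha : Summable fun n => ‖a n‖ ^ 2) :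
    ContinuousOn (powSum a) disc := (differentiableOn_powSum ha).continuousOn

theorem measurable_powSum_comp {a : ℕ → ℂ} (ha : Summable fun n => ‖a n‖ ^ 2) {α : Type*}
    [MeasurableSpace α] {z : α → ℂ} (hz : Measurable z) (h : ∀ x, ‖z x‖ < 1) :
    Measurable fun x => powSum a (z x) := by
  refine measurable_of_tendsto_metrizable (f := fun N x => ∑ n ∈ Finset.range N, a n * z x ^ n)
    (fun N => by fun_prop) ?_
  rw [tendsto_pi_nhds]
  exact fun x => (hasSum_powSum ha (h x)).tendsto_sum_nat

theorem circleMap_eq_mul (r θ : ℝ) : circleMap 0 r θ = r * circleMap 0 1 θ := by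
  simp [circleMap]

theorem norm_circleMap_lt_one {r : ℝ} (hr0 : 0 ≤ r) (hr : r < 1) (θ : ℝ) :
    ‖circleMap 0 r θ‖ < 1 := by
  simpa [abs_of_nonneg hr0] using hr

/-- The `L²` maximal inequality along a measurable choice of radii. -/
theorem integral_normSq_powSum_le {a : ℕ → ℂ} (ha : Summable fun n => ‖a n‖ ^ 2) {ρ : ℝ → ℝ} {r : ℝ}
    (hr : r < 1) (hρ : Measurable ρ) (hρ0 : ∀ θ, 0 ≤ ρ θ) (hρr : ∀ θ, ρ θ ≤ r) :
    ∫ θ, ‖powSum a (ρ θ * circleMap 0 1 θ)‖ ^ 2 ∂circleMeasure ≤ 512 * ∑' n, ‖a n‖ ^ 2 := by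
  have hz : Measurable fun θ : ℝ => (ρ θ * circleMap 0 1 θ : ℂ) := by
    have := (continuous_circleMap 0 1).measurable
    fun_prop
  have bz : ∀ θ, ‖(ρ θ * circleMap 0 1 θ : ℂ)‖ ≤ r := fun θ => by
    rw [norm_ofReal_mul_circleMap, abs_of_nonneg (hρ0 θ)]; exact hρr θ
  have hr0 : 0 ≤ r := (norm_nonneg _).trans (bz 0)
  have bz1 : ∀ θ, ‖(ρ θ * circleMap 0 1 θ : ℂ)‖ < 1 := fun θ => (bz θ).trans_lt hr
  set S := ∑' n, ‖a n‖ ^ 2 with hS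
  -- Duality: the adjoint bound is tested on the conjugate of `T a` itself, so that pairing `a` with
  -- its moments gives `‖T a‖²`.
  set ψ : ℝ → ℂ := fun θ => starRingEnd ℂ (powSum a (ρ θ * circleMap 0 1 θ)) with hψdef
  have hψ : Measurable ψ := Complex.continuous_conj.measurable.comp (measurable_powSum_comp ha hz bz1)
  have hS0 : 0 ≤ S := tsum_nonneg fun _ => by positivity
  set B := (S + 1) / √(1 - r ^ 2) with hB
  have bψ : ∀ θ, ‖ψ θ‖ ≤ B := fun θ => by
    rw [hψdef, RCLike.norm_conj]
    refine (norm_powSum_le ha (bz1 θ)).trans ?_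
    have h1 : 0 < √(1 - r ^ 2) := Real.sqrt_pos.2 (by nlinarith)
    have h2 := bz θ
    rw [hB, hS]
    have h3 : 0 ≤ S + 1 := by linarith
    refine div_le_div_of_nonneg_left h3 h1 (Real.sqrt_le_sqrt ?_)
    have := pow_le_pow_left₀ (norm_nonneg _) h2 2
    linarith
  obtain ⟨hs, hle⟩ := tsum_normSq_le hr hρ hρ0 hρr hψ bψ
  set X := ∫ θ, ‖ψ θ‖ ^ 2 ∂circleMeasure with hX
  have hXe : ∫ θ, ‖powSum a (ρ θ * circleMap 0 1 θ)‖ ^ 2 ∂circleMeasure = X := by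
    simp only [hX, hψdef, RCLike.norm_conj]
  have hB0 : 0 ≤ B := (norm_nonneg _).trans (bψ 0)
  have key : HasSum (fun n => a n * ∫ θ, ψ θ * (ρ θ * circleMap 0 1 θ) ^ n ∂circleMeasure)
      (X : ℂ) := by
    have hbd : ∀ n θ, ‖a n * (ψ θ * (ρ θ * circleMap 0 1 θ) ^ n)‖ ≤ B * ‖a n * (r : ℂ) ^ n‖ := by
      intro n θ
      rw [norm_mul, norm_mul, norm_mul, norm_pow, norm_pow, Complex.norm_real,
        Real.norm_of_nonneg hr0]
      have := bz θ
      have := bψ θ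
      calc ‖a n‖ * (‖ψ θ‖ * ‖(ρ θ * circleMap 0 1 θ : ℂ)‖ ^ n) ≤ ‖a n‖ * (B * r ^ n) := by gcongr
        _ = _ := by ring
    have hi : ∀ n, Integrable (fun θ => a n * (ψ θ * (ρ θ * circleMap 0 1 θ) ^ n))
        circleMeasure := fun n =>
      Integrable.of_bound (Measurable.aestronglyMeasurable (by fun_prop)) _ (ae_of_all _ (hbd n))
    have hsr := (summable_norm_mul_pow ha (z := (r : ℂ))
      (by rwa [Complex.norm_real, Real.norm_of_nonneg hr0])).mul_left B
    have h := hasSum_integral_of_summable_integral_norm hi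
      (Summable.of_nonneg_of_le (fun n => integral_nonneg fun _ => norm_nonneg _) (fun n => by
        calc _ ≤ ∫ θ, B * ‖a n * (r : ℂ) ^ n‖ ∂circleMeasure :=
              integral_mono (hi n).norm (integrable_const _) (hbd n)
          _ = _ := by simp) hsr)
    simp only [integral_const_mul] at h
    have e : ∫ θ, ∑' n, a n * (ψ θ * (ρ θ * circleMap 0 1 θ) ^ n) ∂circleMeasure = (X : ℂ) := by
      rw [hX, ← integral_complex_ofReal]
      congr 1
      ext θ
      have := (hasSum_powSum ha (bz1 θ)).mul_left (ψ θ)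
      rw [show (∑' n, a n * (ψ θ * (ρ θ * circleMap 0 1 θ : ℂ) ^ n)) =
        ψ θ * powSum a (ρ θ * circleMap 0 1 θ) by rw [← this.tsum_eq]; congr 1; ext n; ring]
      rw [hψdef]
      simp only
      rw [mul_comm, Complex.mul_conj, Complex.normSq_eq_norm_sq, RCLike.norm_conj]
    rwa [e] at h
  have hre := Complex.hasSum_re key
  rw [Complex.ofReal_re] at hre
  -- Since the last sum is at most `512 X`, its weight `1/1024` leaves `X/2` to absorb.
  have : X ≤ 256 * S + 1 / 1024 * ∑' n : ℕ,
      ‖∫ θ, ψ θ * (ρ θ * circleMap 0 1 θ) ^ n ∂circleMeasure‖ ^ 2 := by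
    refine hasSum_le (fun n => ?_) hre ((ha.hasSum.mul_left 256).add (hs.hasSum.mul_left (1 / 1024)))
    refine (Complex.re_le_norm _).trans ?_
    rw [norm_mul]
    nlinarith [sq_nonneg (512 * ‖a n‖ - ‖∫ θ, ψ θ * (ρ θ * circleMap 0 1 θ) ^ n ∂circleMeasure‖)]
  rw [hXe]
  linarith

theorem circleMap_mem_disc {r : ℝ} (hr0 : 0 ≤ r) (hr : r < 1) (θ : ℝ) : circleMap 0 r θ ∈ disc := by
  simpa [disc] using norm_circleMap_lt_one hr0 hr θ

/-! ### The radial maximal function in `L²` and radial limits. -/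

/-- The radial maximal function over the radii `s ≤ r < 1`. -/
noncomputable def radialMax (φ : ℂ → ℝ≥0∞) (s θ : ℝ) : ℝ≥0∞ :=
  ⨆ r ∈ Ico s 1, φ (circleMap 0 r θ)

theorem le_radialMax (φ : ℂ → ℝ≥0∞) {s r : ℝ} (hr : r ∈ Ico s 1) (θ : ℝ) :
    φ (circleMap 0 r θ) ≤ radialMax φ s θ :=
  le_iSup₂ (f := fun r (_ : r ∈ Ico s 1) => φ (circleMap 0 r θ)) r hr

/-- An uncountable supremum of continuous functions of `θ` is still lower semicontinuous. -/
theorem measurable_radialMax {φ : ℂ → ℝ≥0∞} (hφ : ContinuousOn φ disc) {s : ℝ} (hs : 0 ≤ s) :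
    Measurable (radialMax φ s) := by
  refine LowerSemicontinuous.measurable (lowerSemicontinuous_biSup fun r hr => ?_)
  refine Continuous.lowerSemicontinuous ?_
  exact hφ.comp_continuous (continuous_circleMap 0 r)
    fun θ => circleMap_mem_disc (hs.trans hr.1) hr.2 θ

theorem radialMax_le_iSup_denseSeq {φ : ℂ → ℝ≥0∞} (hφ : ContinuousOn φ disc)
    {u : ℕ → Ico (0 : ℝ) 1} (hu : DenseRange u) (θ : ℝ) :
    radialMax φ 0 θ ≤ ⨆ i, φ (circleMap 0 (u i) θ) := by
  refine iSup₂_le fun r hr => ?_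
  have hc : Continuous fun x : Ico (0 : ℝ) 1 => φ (circleMap 0 x θ) := by
    refine hφ.comp_continuous ?_ fun x => circleMap_mem_disc x.2.1 x.2.2 θ
    simp only [circleMap]
    fun_prop
  have hcl : IsClosed {x : Ico (0 : ℝ) 1 | φ (circleMap 0 x θ) ≤ ⨆ i, φ (circleMap 0 (u i) θ)} :=
    isClosed_le hc continuous_const
  exact hu.induction_on (p := fun x : Ico (0 : ℝ) 1 =>
    φ (circleMap 0 x θ) ≤ ⨆ i, φ (circleMap 0 (u i) θ)) ⟨r, hr⟩ hcl
    (fun i => le_iSup (fun i => φ (circleMap 0 (u i) θ)) i)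

/-- A measurable selection of the radius, among finitely many, at which a function is maximal. -/
theorem exists_measurable_argmax {φ : ℂ → ℝ≥0∞} (hφ : ContinuousOn φ disc)
    (u : ℕ → Ico (0 : ℝ) 1) (k : ℕ) :
    ∃ ρ : ℝ → ℝ, Measurable ρ ∧ (∃ i ≤ k, ∀ θ, ρ θ ≤ u i) ∧ (∀ θ, ∃ i ≤ k, ρ θ = u i) ∧
      (Measurable fun θ => φ (circleMap 0 (ρ θ) θ)) ∧
      ∀ θ, ∀ i ≤ k, φ (circleMap 0 (u i) θ) ≤ φ (circleMap 0 (ρ θ) θ) := by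
  have hm : ∀ i, Measurable fun θ => φ (circleMap 0 (u i) θ) := fun i =>
    (hφ.comp_continuous (continuous_circleMap 0 (u i))
      fun θ => circleMap_mem_disc (u i).2.1 (u i).2.2 θ).measurable
  induction k with
  | zero =>
    refine ⟨fun _ => u 0, measurable_const, ⟨0, le_rfl, fun _ => le_rfl⟩,
      fun _ => ⟨0, le_rfl, rfl⟩, hm 0, fun θ i hi => ?_⟩
    rw [Nat.le_zero.1 hi]
  | succ k ih =>
    obtain ⟨ρ, h1, ⟨j, hj, h2⟩, h3, h4, h5⟩ := ih
    set s : Set ℝ := {θ | φ (circleMap 0 (ρ θ) θ) < φ (circleMap 0 (u (k + 1)) θ)} with hs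
    have ms : MeasurableSet s := measurableSet_lt h4 (hm _)
    classical
    refine ⟨s.piecewise (fun _ => u (k + 1)) ρ, Measurable.piecewise ms measurable_const h1,
      ?_, ?_, ?_, ?_⟩
    · rcases le_total (u j) (u (k + 1)) with h | h
      · refine ⟨k + 1, le_rfl, fun θ => ?_⟩
        by_cases hθ : θ ∈ s
        · simp [hθ]
        · simpa [hθ] using (h2 θ).trans h
      · refine ⟨j, by omega, fun θ => ?_⟩
        by_cases hθ : θ ∈ s
        · simpa [hθ] using h
        · simpa [hθ] using h2 θ
    · intro θ
      by_cases hθ : θ ∈ s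
      · exact ⟨k + 1, le_rfl, by simp [hθ]⟩
      · obtain ⟨i, hi, e⟩ := h3 θ
        exact ⟨i, by omega, by simp [hθ, e]⟩
    · have : (fun θ => φ (circleMap 0 (s.piecewise (fun _ => (u (k + 1) : ℝ)) ρ θ) θ)) =
          s.piecewise (fun θ => φ (circleMap 0 (u (k + 1)) θ))
            (fun θ => φ (circleMap 0 (ρ θ) θ)) := by
        ext θ
        by_cases hθ : θ ∈ s <;> simp [hθ]
      rw [this]
      exact Measurable.piecewise ms (hm _) h4
    · intro θ i hi
      by_cases hθ : θ ∈ s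
      · simp only [hθ, Set.piecewise_eq_of_mem]
        rcases Nat.le_succ_iff.1 hi with h | h
        · exact (h5 θ i h).trans (le_of_lt hθ)
        · rw [h]
      · simp only [hθ, not_false_eq_true, Set.piecewise_eq_of_notMem]
        rcases Nat.le_succ_iff.1 hi with h | h
        · exact h5 θ i h
        · rw [h]; exact not_lt.1 hθ

theorem continuousOn_enorm_sq_powSum {a : ℕ → ℂ} (ha : Summable fun n => ‖a n‖ ^ 2) :
    ContinuousOn (fun z => ‖powSum a z‖ₑ ^ 2) disc :=
  (ENNReal.continuous_pow 2).comp_continuousOn (continuousOn_powSum ha).enorm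

/-- The `L²` radial maximal inequality. -/
theorem lintegral_radialMax_powSum_le {a : ℕ → ℂ} (ha : Summable fun n => ‖a n‖ ^ 2) :
    ∫⁻ θ, radialMax (fun z => ‖powSum a z‖ₑ ^ 2) 0 θ ∂circleMeasure ≤
      ENNReal.ofReal (512 * ∑' n, ‖a n‖ ^ 2) := by
  have hne : Nonempty (Ico (0 : ℝ) 1) := ⟨⟨0, by simp⟩⟩
  set u := TopologicalSpace.denseSeq (Ico (0 : ℝ) 1)
  have hu : DenseRange u := TopologicalSpace.denseRange_denseSeq _
  have hφ := continuousOn_enorm_sq_powSum ha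
  set φ : ℂ → ℝ≥0∞ := fun z => ‖powSum a z‖ₑ ^ 2 with hφdef
  have hm : ∀ i, Measurable fun θ => φ (circleMap 0 (u i) θ) := fun i =>
    (hφ.comp_continuous (continuous_circleMap 0 (u i))
      fun θ => circleMap_mem_disc (u i).2.1 (u i).2.2 θ).measurable
  calc ∫⁻ θ, radialMax φ 0 θ ∂circleMeasure
      ≤ ∫⁻ θ, ⨆ k : ℕ, ⨆ i ≤ k, φ (circleMap 0 (u i) θ) ∂circleMeasure := by
        refine lintegral_mono fun θ => (radialMax_le_iSup_denseSeq hφ hu θ).trans ?_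
        exact iSup_le fun i => le_iSup_of_le i (le_iSup₂_of_le i le_rfl le_rfl)
    _ = ⨆ k : ℕ, ∫⁻ θ, ⨆ i ≤ k, φ (circleMap 0 (u i) θ) ∂circleMeasure := by
        refine lintegral_iSup (fun k => ?_) fun k l hkl θ => ?_
        · exact Measurable.iSup fun i => Measurable.iSup fun _ => hm i
        · exact iSup₂_le fun i hi => le_iSup₂_of_le i (hi.trans hkl) le_rfl
    _ ≤ _ := by
        refine iSup_le fun k => ?_
        -- With finitely many radii the selection stays below one `u j < 1`, as the linearized
        -- inequality requires; its constant `512` is independent of `j`, hence uniform in `k`.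
        obtain ⟨ρ, h1, ⟨j, hj, h2⟩, h3, h4, h5⟩ := exists_measurable_argmax hφ u k
        have hρ0 : ∀ θ, 0 ≤ ρ θ := fun θ => by
          obtain ⟨i, -, e⟩ := h3 θ
          rw [e]; exact (u i).2.1
        refine (lintegral_mono fun θ => iSup₂_le (h5 θ)).trans ?_
        have key := integral_normSq_powSum_le ha (u j).2.2 h1 hρ0 h2
        refine le_trans (le_of_eq ?_) (ENNReal.ofReal_le_ofReal key)
        have hz : Measurable fun θ : ℝ => (ρ θ * circleMap 0 1 θ : ℂ) := by
          have := (continuous_circleMap 0 1).measurable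
          fun_prop
        have bz : ∀ θ, ‖(ρ θ * circleMap 0 1 θ : ℂ)‖ ≤ u j := fun θ => by
          rw [norm_ofReal_mul_circleMap, abs_of_nonneg (hρ0 θ)]; exact h2 θ
        have hmeas := measurable_powSum_comp ha hz fun θ => (bz θ).trans_lt (u j).2.2
        have hint : Integrable (fun θ => ‖powSum a (ρ θ * circleMap 0 1 θ)‖ ^ 2) circleMeasure := by
          refine Integrable.of_bound (C := ((∑' n, ‖a n‖ ^ 2 + 1) / √(1 - (u j : ℝ) ^ 2)) ^ 2)
            (Measurable.aestronglyMeasurable (by fun_prop)) (ae_of_all _ fun θ => ?_)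
          rw [norm_pow, norm_norm]
          refine pow_le_pow_left₀ (norm_nonneg _) ?_ 2
          refine (norm_powSum_le ha ((bz θ).trans_lt (u j).2.2)).trans ?_
          have g1 : 0 ≤ (∑' n, ‖a n‖ ^ 2) + 1 := by
            have : 0 ≤ ∑' n, ‖a n‖ ^ 2 := tsum_nonneg fun _ => by positivity
            linarith
          have g2 : 0 < 1 - (u j : ℝ) ^ 2 := by
            have := (u j).2.1; have := (u j).2.2; nlinarith
          refine div_le_div_of_nonneg_left g1 (Real.sqrt_pos.2 g2) (Real.sqrt_le_sqrt ?_)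
          have := pow_le_pow_left₀ (norm_nonneg _) (bz θ) 2
          linarith
        rw [ofReal_integral_eq_lintegral_ofReal hint (ae_of_all _ fun θ => by positivity)]
        refine lintegral_congr fun θ => ?_
        rw [hφdef, ENNReal.ofReal_pow (norm_nonneg _), ofReal_norm, circleMap_eq_mul]

/-- Fatou's theorem for power series with square summable coefficients. -/
theorem ae_exists_tendsto_powSum {a : ℕ → ℂ} (ha : Summable fun n => ‖a n‖ ^ 2) :
    ∀ᵐ θ ∂circleMeasure, ∃ w : ℂ,
      Tendsto (fun r : ℝ => powSum a (circleMap 0 r θ)) (𝓝[<] (1 : ℝ)) (𝓝 w) := by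
  have hK : ∀ K, Summable fun n => ‖a (n + K)‖ ^ 2 := fun K =>
    (summable_nat_add_iff (f := fun n => ‖a n‖ ^ 2) K).2 ha
  set W : ℕ → ℝ → ℝ≥0∞ := fun K => radialMax (fun z => ‖powSum (fun n => a (n + K)) z‖ₑ ^ 2) 0
  have mW : ∀ K, Measurable (W K) := fun K =>
    measurable_radialMax (continuousOn_enorm_sq_powSum (hK K)) le_rfl
  -- The maximal inequality for the tails: their `ℓ²` norms tend to `0`, so by Fatou's lemma almost
  -- every ray has tails uniformly small along it.
  have h0 : ∫⁻ θ, liminf (fun K => W K θ) atTop ∂circleMeasure = 0 := by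
    refine le_antisymm ((lintegral_liminf_le mW).trans ?_) zero_le
    have hlim : Tendsto (fun K => ENNReal.ofReal (512 * ∑' n, ‖a (n + K)‖ ^ 2)) atTop (𝓝 0) := by
      have := (tendsto_sum_nat_add fun n => ‖a n‖ ^ 2).const_mul 512
      rw [mul_zero] at this
      simpa using ENNReal.tendsto_ofReal this
    rw [← hlim.liminf_eq]
    exact liminf_le_liminf (Eventually.of_forall fun K => lintegral_radialMax_powSum_le (hK K))
  rw [lintegral_eq_zero_iff (Measurable.liminf mW)] at h0
  filter_upwards [h0] with θ hθ
  have hsmall : ∀ ε : ℝ, 0 < ε → ∃ K, ∀ r ∈ Ico (0 : ℝ) 1,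
      ‖powSum (fun n => a (n + K)) (circleMap 0 r θ)‖ < ε := by
    intro ε hε
    have hlt : liminf (fun K => W K θ) atTop < ENNReal.ofReal ε ^ 2 := by
      rw [hθ]; exact ENNReal.pow_pos (ENNReal.ofReal_pos.2 hε) 2
    obtain ⟨K, hKlt⟩ := (frequently_lt_of_liminf_lt (by isBoundedDefault) hlt).exists
    refine ⟨K, fun r hr => ?_⟩
    have h1 := (le_radialMax (fun z => ‖powSum (fun n => a (n + K)) z‖ₑ ^ 2) hr θ).trans_lt hKlt
    have h2 := lt_of_not_ge fun h => absurd (pow_le_pow_left' h 2) (not_le.2 h1)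
    rwa [← ofReal_norm, ENNReal.ofReal_lt_ofReal_iff hε] at h2
  refine cauchy_map_iff_exists_tendsto.1 ?_
  rw [Metric.cauchy_iff]
  refine ⟨inferInstance, fun ε hε => ?_⟩
  obtain ⟨K, hKs⟩ := hsmall (ε / 4) (by linarith)
  -- The Cauchy criterion: a partial sum, continuous up to `r = 1`, plus a tail below `ε/4` on the
  -- whole radius.
  set P : ℝ → ℂ := fun r => ∑ n ∈ Finset.range K, a n * circleMap 0 r θ ^ n with hP
  have hPc : Continuous P := by
    simp only [hP, circleMap]
    fun_prop
  have hPl : ∀ᶠ r in 𝓝[<] (1 : ℝ), dist (P r) (P 1) < ε / 4 :=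
    (hPc.tendsto 1).mono_left nhdsWithin_le_nhds (Metric.ball_mem_nhds _ (by linarith))
  refine ⟨Metric.ball (P 1) (ε / 2), ?_, fun x hx y hy => ?_⟩
  · rw [mem_map]
    filter_upwards [hPl, Ico_mem_nhdsLT (zero_lt_one' ℝ)] with r hr1 hr2
    have hz := norm_circleMap_lt_one hr2.1 hr2.2 θ
    have hd : powSum a (circleMap 0 r θ) =
        P r + circleMap 0 r θ ^ K * powSum (fun n => a (n + K)) (circleMap 0 r θ) := by
      have := (summable_norm_mul_pow ha hz).of_norm.sum_add_tsum_nat_add K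
      rw [powSum, ← this, powSum, ← tsum_mul_left]
      congr 1
      refine tsum_congr fun n => ?_
      rw [pow_add]; ring
    have hb : ‖circleMap 0 r θ ^ K * powSum (fun n => a (n + K)) (circleMap 0 r θ)‖ < ε / 4 := by
      rw [norm_mul, norm_pow]
      refine lt_of_le_of_lt ?_ (hKs r hr2)
      exact mul_le_of_le_one_left (norm_nonneg _) (pow_le_one₀ (norm_nonneg _) hz.le)
    rw [mem_preimage, Metric.mem_ball, hd]
    calc _ ≤ dist (P r + circleMap 0 r θ ^ K * powSum (fun n => a (n + K)) (circleMap 0 r θ)) (P r) +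
          dist (P r) (P 1) := dist_triangle _ _ _
      _ < ε / 4 + ε / 4 := by
          rw [dist_self_add_left]
          exact add_lt_add hb hr1
      _ = ε / 2 := by ring
  · calc dist x y ≤ dist x (P 1) + dist y (P 1) := dist_triangle_right _ _ _
      _ < ε / 2 + ε / 2 := add_lt_add hx hy
      _ = ε := by ring

/-! ### Balanced factorization of polynomials. -/

open Polynomial in
/-- A polynomial `p` is a product of two holomorphic functions on the disc whose squares are
dominated by a polynomial with the same absolute value as `p` on the unit circle. -/
def HasBalancedFactorization (p : ℂ[X]) : Prop :=
  ∃ (q : ℂ[X]) (F G : ℂ → ℂ), DifferentiableOn ℂ F disc ∧ DifferentiableOn ℂ G disc ∧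
    (∀ z ∈ disc, p.eval z = F z * G z ∧ ‖F z‖ ^ 2 ≤ ‖q.eval z‖ ∧ ‖G z‖ ^ 2 ≤ ‖q.eval z‖) ∧
    ∀ z, ‖z‖ = 1 → ‖q.eval z‖ = ‖p.eval z‖

theorem HasBalancedFactorization.mul {p₁ p₂ : Polynomial ℂ} (h₁ : HasBalancedFactorization p₁)
    (h₂ : HasBalancedFactorization p₂) : HasBalancedFactorization (p₁ * p₂) := by
  obtain ⟨q₁, F₁, G₁, dF₁, dG₁, e₁, c₁⟩ := h₁
  obtain ⟨q₂, F₂, G₂, dF₂, dG₂, e₂, c₂⟩ := h₂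
  refine ⟨q₁ * q₂, fun z => F₁ z * F₂ z, fun z => G₁ z * G₂ z, dF₁.mul dF₂, dG₁.mul dG₂,
    fun z hz => ⟨?_, ?_, ?_⟩, fun z hz => ?_⟩
  · rw [Polynomial.eval_mul, (e₁ z hz).1, (e₂ z hz).1]; ring
  · rw [Polynomial.eval_mul, norm_mul, norm_mul, mul_pow]
    exact mul_le_mul (e₁ z hz).2.1 (e₂ z hz).2.1 (by positivity) (norm_nonneg _)
  · rw [Polynomial.eval_mul, norm_mul, norm_mul, mul_pow]
    exact mul_le_mul (e₁ z hz).2.2 (e₂ z hz).2.2 (by positivity) (norm_nonneg _)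
  · simp only [Polynomial.eval_mul, norm_mul, c₁ z hz, c₂ z hz]

theorem exists_sq_eq (c : ℂ) : ∃ s : ℂ, s ^ 2 = c := IsAlgClosed.exists_pow_nat_eq c two_pos

theorem hasBalancedFactorization_C (c : ℂ) : HasBalancedFactorization (Polynomial.C c) := by
  obtain ⟨s, hs⟩ := exists_sq_eq c
  refine ⟨Polynomial.C c, fun _ => s, fun _ => s, by fun_prop, by fun_prop,
    fun z _ => ⟨?_, ?_, ?_⟩, fun _ _ => rfl⟩
  · rw [Polynomial.eval_C, ← hs, sq]
  all_goals rw [Polynomial.eval_C, ← hs, norm_pow]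

/-- The holomorphic square root of `1 - v` on the unit disc. -/
theorem exists_sqrt_one_sub : ∃ S : ℂ → ℂ, (∀ v, ‖v‖ < 1 → DifferentiableAt ℂ S v) ∧
    ∀ v, S v ^ 2 = 1 - v := by
  refine ⟨fun v => (1 - v) ^ (((2 : ℕ) : ℂ)⁻¹), fun v hv => ?_,
    fun v => Complex.cpow_nat_inv_pow _ two_ne_zero⟩
  have : (1 - v) ∈ Complex.slitPlane := by
    refine Complex.mem_slitPlane_iff.2 (Or.inl ?_)
    have := (Complex.re_le_norm v).trans_lt hv
    simp only [Complex.sub_re, Complex.one_re]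
    linarith
  exact ((differentiableAt_const _).sub differentiableAt_id).cpow (differentiableAt_const _) this

/-- The Blaschke factor identity: `|z - w| ≤ |1 - w̄z|` inside the disc when `|w| < 1`, with
equality on the circle. -/
theorem norm_one_sub_conj_mul_sq (w z : ℂ) :
    ‖1 - starRingEnd ℂ w * z‖ ^ 2 = ‖z - w‖ ^ 2 + (1 - ‖z‖ ^ 2) * (1 - ‖w‖ ^ 2) := by
  simp only [← Complex.normSq_eq_norm_sq, Complex.normSq_apply]
  simp
  ring

/-- A root inside the disc is reflected: `q = 1 - w̄z` has no zero there, and `z - w` is the product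
of `(z - w)/√q` and `√q`. For `|w| ≥ 1` the factor `z - w` has itself a holomorphic square root, and
`q` is that factor. -/
theorem hasBalancedFactorization_X_sub_C (w : ℂ) :
    HasBalancedFactorization (Polynomial.X - Polynomial.C w) := by
  obtain ⟨S, dS, hS⟩ := exists_sqrt_one_sub
  rcases lt_or_ge ‖w‖ 1 with hw | hw
  · have hv : ∀ z ∈ disc, ‖starRingEnd ℂ w * z‖ < 1 := fun z hz => by
      have hz' : ‖z‖ < 1 := by simpa [disc] using hz
      rw [norm_mul, RCLike.norm_conj]
      nlinarith [norm_nonneg w, norm_nonneg z]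
    have hne : ∀ z ∈ disc, S (starRingEnd ℂ w * z) ≠ 0 := fun z hz h => by
      have h1 := hS (starRingEnd ℂ w * z)
      rw [h, zero_pow two_ne_zero] at h1
      have h2 := hv z hz
      rw [← sub_eq_zero.1 h1.symm, norm_one] at h2
      exact lt_irrefl _ h2
    have dG : DifferentiableOn ℂ (fun z => S (starRingEnd ℂ w * z)) disc := fun z hz =>
      ((dS _ (hv z hz)).comp z
        (differentiableAt_id.const_mul (starRingEnd ℂ w))).differentiableWithinAt
    refine ⟨1 - Polynomial.C (starRingEnd ℂ w) * Polynomial.X,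
      fun z => (z - w) / S (starRingEnd ℂ w * z), fun z => S (starRingEnd ℂ w * z),
      DifferentiableOn.div (by fun_prop) dG hne, dG, fun z hz => ⟨?_, ?_, ?_⟩, fun z hz => ?_⟩
    · simp [div_mul_cancel₀ _ (hne z hz)]
    · have h1 : ‖S (starRingEnd ℂ w * z)‖ ^ 2 = ‖1 - starRingEnd ℂ w * z‖ := by
        rw [← norm_pow, hS]
      have h2 := norm_one_sub_conj_mul_sq w z
      have hz' : ‖z‖ < 1 := by simpa [disc] using hz
      have h3 : 0 < ‖S (starRingEnd ℂ w * z)‖ ^ 2 := by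
        have := norm_pos_iff.2 (hne z hz); positivity
      have h4 : 0 ≤ (1 - ‖z‖ ^ 2) * (1 - ‖w‖ ^ 2) := by
        apply mul_nonneg <;> nlinarith [norm_nonneg z, norm_nonneg w]
      rw [norm_div, div_pow, h1]
      rw [h1] at h3
      simp only [Polynomial.eval_sub, Polynomial.eval_one, Polynomial.eval_mul, Polynomial.eval_C,
        Polynomial.eval_X]
      rw [div_le_iff₀ h3]
      nlinarith
    · simp [← norm_pow, hS]
    · have h2 := norm_one_sub_conj_mul_sq w z
      rw [hz] at h2
      have h3 : ‖1 - starRingEnd ℂ w * z‖ ^ 2 = ‖z - w‖ ^ 2 := by rw [h2]; ring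
      have := (pow_left_inj₀ (norm_nonneg _) (norm_nonneg _) two_ne_zero).1 h3
      simpa using this
  · obtain ⟨s, hs⟩ := exists_sq_eq (-w)
    have hw0 : w ≠ 0 := by rintro rfl; simp at hw; linarith
    have hv : ∀ z ∈ disc, ‖w⁻¹ * z‖ < 1 := fun z hz => by
      have hz' : ‖z‖ < 1 := by simpa [disc] using hz
      rw [norm_mul, norm_inv, inv_mul_lt_iff₀ (by linarith)]
      linarith
    have dG : DifferentiableOn ℂ (fun z => s * S (w⁻¹ * z)) disc := fun z hz =>
      (((dS _ (hv z hz)).comp z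
        (differentiableAt_id.const_mul (w⁻¹))).const_mul s).differentiableWithinAt
    have hsq : ∀ z, (s * S (w⁻¹ * z)) ^ 2 = z - w := fun z => by
      rw [mul_pow, hs, hS]; field_simp; ring
    refine ⟨Polynomial.X - Polynomial.C w, _, _, dG, dG, fun z hz => ⟨?_, ?_, ?_⟩, fun _ _ => rfl⟩
    · rw [← sq, hsq]; simp
    all_goals rw [← norm_pow, hsq]; simp

/-- The property is multiplicative, so it reduces to linear factors and constants; finite products
take the place of an infinite Blaschke product. -/
theorem hasBalancedFactorization (p : Polynomial ℂ) : HasBalancedFactorization p := by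
  rw [(IsAlgClosed.splits p).eq_prod_roots]
  refine (hasBalancedFactorization_C _).mul ?_
  induction p.roots using Multiset.induction with
  | empty => simpa using hasBalancedFactorization_C 1
  | cons w s ih =>
    rw [Multiset.map_cons, Multiset.prod_cons]
    exact (hasBalancedFactorization_X_sub_C w).mul ih

/-! ### Factorization of `H¹` into power series with `ℓ²` coefficients. -/

theorem integral_circleMap_pow_mul_conj_pow (m n : ℕ) :
    ∫ θ, circleMap 0 1 θ ^ m * (starRingEnd ℂ (circleMap 0 1 θ)) ^ n ∂circleMeasure =
      if m = n then 1 else 0 := by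
  have e : ∀ θ : ℝ, circleMap 0 1 θ ^ m * (starRingEnd ℂ (circleMap 0 1 θ)) ^ n =
      Complex.exp (((m - n : ℤ) * Complex.I) * θ) := by
    intro θ
    simp only [circleMap, zero_add, Complex.ofReal_one, one_mul, ← Complex.exp_conj,
      ← Complex.exp_nat_mul, ← Complex.exp_add]
    congr 1
    simp
    ring
  simp only [e]
  split_ifs with h
  · simp [h]
  · have hc : ((m - n : ℤ) * Complex.I : ℂ) ≠ 0 := by
      refine mul_ne_zero ?_ Complex.I_ne_zero
      rw [Int.cast_ne_zero]; omega
    rw [integral_circleMeasure, integral_exp_mul_complex hc]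
    have : Complex.exp ((m - n : ℤ) * Complex.I * ((2 * Real.pi : ℝ) : ℂ)) = 1 := by
      rw [Complex.exp_eq_one_iff]
      exact ⟨m - n, by push_cast; ring⟩
    rw [this]
    simp

theorem exists_hasSum_of_differentiableOn_disc {F : ℂ → ℂ} (hF : DifferentiableOn ℂ F disc) :
    ∃ a : ℕ → ℂ, ∀ z ∈ disc, HasSum (fun n => a n * z ^ n) (F z) := by
  refine ⟨fun n => (n.factorial : ℂ)⁻¹ * iteratedDeriv n F 0, fun z hz => ?_⟩
  refine (Complex.hasSum_taylorSeries_on_ball hF hz).congr_fun fun n => ?_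
  simp only [sub_zero, smul_eq_mul]
  ring

theorem summable_norm_mul_pow_of_hasSum {F : ℂ → ℂ} {a : ℕ → ℂ}
    (h : ∀ z ∈ disc, HasSum (fun n => a n * z ^ n) (F z)) {s : ℝ} (hs0 : 0 ≤ s) (hs : s < 1) :
    Summable fun n => ‖a n‖ * s ^ n := by
  have := (h (s : ℂ) (by simpa [disc, abs_of_nonneg hs0] using hs)).summable.norm
  simpa [abs_of_nonneg hs0] using this

/-- Bessel's inequality on the circle of radius `s`. -/
theorem sum_normSq_mul_pow_le {F : ℂ → ℂ} (hF : ContinuousOn F disc) {a : ℕ → ℂ}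
    (h : ∀ z ∈ disc, HasSum (fun n => a n * z ^ n) (F z)) {s : ℝ} (hs0 : 0 ≤ s) (hs : s < 1)
    (N : ℕ) :
    ∑ n ∈ Finset.range N, (‖a n‖ * s ^ n) ^ 2 ≤
      ∫ θ, ‖F (circleMap 0 s θ)‖ ^ 2 ∂circleMeasure := by
  have hc : Continuous fun θ => F (circleMap 0 s θ) :=
    hF.comp_continuous (continuous_circleMap 0 s) fun θ => circleMap_mem_disc hs0 hs θ
  have hsum := summable_norm_mul_pow_of_hasSum h hs0 hs
  have hb : ∀ θ, ‖F (circleMap 0 s θ)‖ ≤ ∑' n, ‖a n‖ * s ^ n := fun θ => by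
    have h1 := h _ (circleMap_mem_disc hs0 hs θ)
    have e : (fun n => ‖a n * circleMap 0 s θ ^ n‖) = fun n => ‖a n‖ * s ^ n := by
      ext n; simp [abs_of_nonneg hs0]
    rw [← h1.tsum_eq]
    refine (norm_tsum_le_tsum_norm (by rw [e]; exact hsum)).trans_eq ?_
    rw [e]
  have hm : MemLp (fun θ => F (circleMap 0 s θ)) 2 circleMeasure :=
    MemLp.of_bound hc.aestronglyMeasurable _ (ae_of_all _ hb)
  obtain ⟨h1, h2⟩ := bessel_circleMeasure hm
  refine le_trans ?_ h2
  have hco : ∀ n : ℕ, ∫ θ, F (circleMap 0 s θ) * (starRingEnd ℂ (circleMap 0 1 θ)) ^ n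
      ∂circleMeasure = a n * s ^ n := by
    intro n
    set f : ℕ → ℝ → ℂ := fun m θ =>
      (a m * s ^ m) * (circleMap 0 1 θ ^ m * (starRingEnd ℂ (circleMap 0 1 θ)) ^ n) with hf
    have hnf : ∀ m θ, ‖f m θ‖ = ‖a m‖ * s ^ m := fun m θ => by
      simp [hf, abs_of_nonneg hs0]
    have hi : ∀ m, Integrable (f m) circleMeasure := fun m => by
      refine Integrable.of_bound (Continuous.aestronglyMeasurable ?_) (‖a m‖ * s ^ m)
        (ae_of_all _ fun θ => (hnf m θ).le)
      have h1 := continuous_circleMap 0 1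
      have h2 := Complex.continuous_conj.comp h1
      exact continuous_const.mul ((h1.pow m).mul (h2.pow n))
    have key := hasSum_integral_of_summable_integral_norm hi (by simpa [hnf] using hsum)
    have e1 : ∀ m, ∫ θ, f m θ ∂circleMeasure = if m = n then a n * s ^ n else 0 := fun m => by
      rw [hf, integral_const_mul, integral_circleMap_pow_mul_conj_pow]
      split_ifs with hmn <;> simp [hmn]
    have e2 : ∀ θ, ∑' m, f m θ =
        F (circleMap 0 s θ) * (starRingEnd ℂ (circleMap 0 1 θ)) ^ n := fun θ => by
      have h3 := (h _ (circleMap_mem_disc hs0 hs θ)).mul_right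
        ((starRingEnd ℂ (circleMap 0 1 θ)) ^ n)
      rw [← h3.tsum_eq]
      refine tsum_congr fun m => ?_
      rw [hf, circleMap_eq_mul s θ, mul_pow]
      ring
    simp only [e1, e2] at key
    exact key.unique (hasSum_ite_eq n _)
  have e : ∀ n, (‖a n‖ * s ^ n) ^ 2 = ‖∫ θ, F (circleMap 0 s θ) *
      (starRingEnd ℂ (circleMap 0 1 θ)) ^ n ∂circleMeasure‖ ^ 2 := fun n => by
    rw [hco]; simp [abs_of_nonneg hs0]
  simp only [e]
  exact h1.sum_le_tsum _ fun _ _ => by positivity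

theorem continuous_integral_norm_polynomial (q : Polynomial ℂ) :
    Continuous fun s : ℝ => ∫ θ, ‖q.eval (circleMap 0 s θ)‖ ∂circleMeasure := by
  simp only [integral_circleMeasure]
  have h : Continuous (Function.uncurry fun s θ : ℝ => ‖q.eval (circleMap 0 s θ)‖) := by
    simp only [Function.uncurry_def, circleMap]
    have := q.continuous
    fun_prop
  exact (intervalIntegral.continuous_parametric_intervalIntegral_of_continuous' (μ := volume)
    h 0 (2 * Real.pi)).const_smul ((2 * Real.pi)⁻¹)

theorem integrable_norm_polynomial (q : Polynomial ℂ) (s : ℝ) :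
    Integrable (fun θ => ‖q.eval (circleMap 0 s θ)‖) circleMeasure := by
  have hc : Continuous fun θ => ‖q.eval (circleMap 0 s θ)‖ :=
    (q.continuous.comp (continuous_circleMap 0 s)).norm
  obtain ⟨C, hC⟩ := (isCompact_sphere (0 : ℂ) |s|).exists_bound_of_continuousOn
    q.continuous.continuousOn
  exact Integrable.of_bound hc.aestronglyMeasurable C (ae_of_all _ fun θ => by
    rw [norm_norm]; exact hC _ (circleMap_mem_sphere' 0 s θ))

/-- The `ℓ²` bound of the coefficients of a factor of a balanced factorization. -/
theorem exists_powSum_of_normSq_le {F : ℂ → ℂ} (hF : DifferentiableOn ℂ F disc) {q : Polynomial ℂ}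
    (hFq : ∀ z ∈ disc, ‖F z‖ ^ 2 ≤ ‖q.eval z‖) {A : ℝ}
    (hA : ∫ θ, ‖q.eval (circleMap 0 1 θ)‖ ∂circleMeasure ≤ A) :
    ∃ a : ℕ → ℂ, (∀ N, ∑ n ∈ Finset.range N, ‖a n‖ ^ 2 ≤ A) ∧ ∀ z ∈ disc, F z = powSum a z := by
  obtain ⟨a, ha⟩ := exists_hasSum_of_differentiableOn_disc hF
  refine ⟨a, fun N => ?_, fun z hz => (ha z hz).tsum_eq.symm⟩
  refine le_trans ?_ hA
  have h1 : Tendsto (fun s : ℝ => ∑ n ∈ Finset.range N, (‖a n‖ * s ^ n) ^ 2) (𝓝[<] 1)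
      (𝓝 (∑ n ∈ Finset.range N, ‖a n‖ ^ 2)) := by
    have : Continuous fun s : ℝ => ∑ n ∈ Finset.range N, (‖a n‖ * s ^ n) ^ 2 := by fun_prop
    simpa using (this.tendsto 1).mono_left (nhdsWithin_le_nhds (s := Iio 1))
  have h2 := ((continuous_integral_norm_polynomial q).tendsto 1).mono_left
    (nhdsWithin_le_nhds (s := Iio 1))
  -- The factors are controlled only inside the disc, so Bessel is applied on radius `s < 1`; the
  -- polynomial `q` lets `s → 1` on the right.
  refine le_of_tendsto_of_tendsto h1 h2 ?_
  filter_upwards [Ico_mem_nhdsLT (zero_lt_one' ℝ)] with s hs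
  refine (sum_normSq_mul_pow_le hF.continuousOn ha hs.1 hs.2 N).trans ?_
  refine integral_mono_of_nonneg (ae_of_all _ fun _ => by positivity)
    (integrable_norm_polynomial q s) (ae_of_all _ fun θ => ?_)
  exact hFq _ (circleMap_mem_disc hs.1 hs.2 θ)

theorem summable_of_sum_normSq_le {a : ℕ → ℂ} {A : ℝ}
    (h : ∀ N, ∑ n ∈ Finset.range N, ‖a n‖ ^ 2 ≤ A) : Summable fun n => ‖a n‖ ^ 2 :=
  summable_of_sum_range_le (fun _ => by positivity) h

/-- Compactness of bounded sets of coefficients, along an ultrafilter. -/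
theorem exists_tendsto_powSum (U : Ultrafilter ℕ) {a : ℕ → ℕ → ℂ} {A : ℝ}
    (h : ∀ k N, ∑ n ∈ Finset.range N, ‖a k n‖ ^ 2 ≤ A) :
    ∃ b : ℕ → ℂ, (∀ N, ∑ n ∈ Finset.range N, ‖b n‖ ^ 2 ≤ A) ∧
      ∀ z ∈ disc, Tendsto (fun k => powSum (a k) z) U (𝓝 (powSum b z)) := by
  have hbd : ∀ k n, ‖a k n‖ ≤ √A := fun k n => by
    refine Real.le_sqrt_of_sq_le (le_trans ?_ (h k (n + 1)))
    exact Finset.single_le_sum (f := fun n => ‖a k n‖ ^ 2) (fun _ _ => by positivity)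
      (Finset.self_mem_range_succ n)
  have hlim : ∀ n, ∃ c, Tendsto (fun k => a k n) U (𝓝 c) := fun n => by
    obtain ⟨c, -, hc⟩ := (isCompact_closedBall (0 : ℂ) (√A)).ultrafilter_le_nhds
      (U.map fun k => a k n) (by
        rw [le_principal_iff, Ultrafilter.mem_coe, Ultrafilter.mem_map]
        exact univ_mem' fun k => by simpa using hbd k n)
    exact ⟨c, hc⟩
  choose b hb using hlim
  refine ⟨b, fun N => ?_, fun z hz => ?_⟩
  · refine le_of_tendsto (tendsto_finsetSum _ fun n _ => ((hb n).norm.pow 2))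
      (Eventually.of_forall fun k => h k N)
  · have hz' : ‖z‖ < 1 := by simpa [disc] using hz
    refine tendsto_tsum_of_dominated_convergence (bound := fun n => √A * ‖z‖ ^ n)
      ((summable_geometric_of_lt_one (norm_nonneg _) hz').mul_left _)
      (fun n => (hb n).mul_const _) (Eventually.of_forall fun k n => ?_)
    rw [norm_mul, norm_pow]
    exact mul_le_mul_of_nonneg_right (hbd k n) (by positivity)

/-- The dilate `z ↦ g(ρz)` has an absolutely convergent Taylor series on the closed disc; truncate
it. -/
theorem exists_polynomial_approx {g : ℂ → ℂ} (hg : DifferentiableOn ℂ g disc) {ρ : ℝ}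
    (hρ0 : 0 ≤ ρ) (hρ : ρ < 1) {ε : ℝ} (hε : 0 < ε) :
    ∃ q : Polynomial ℂ, ∀ z, ‖z‖ ≤ 1 → ‖q.eval z - g (ρ * z)‖ ≤ ε := by
  obtain ⟨c, hc⟩ := exists_hasSum_of_differentiableOn_disc hg
  have hs := summable_norm_mul_pow_of_hasSum hc hρ0 hρ
  obtain ⟨N, hN⟩ := ((tendsto_sum_nat_add fun n => ‖c n‖ * ρ ^ n).eventually
    (gt_mem_nhds hε)).exists
  refine ⟨∑ n ∈ Finset.range N, Polynomial.C (c n * ρ ^ n) * Polynomial.X ^ n, fun z hz => ?_⟩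
  have hz' : (ρ * z : ℂ) ∈ disc := by
    simp only [disc, Metric.mem_ball, dist_zero_right, norm_mul, Complex.norm_real,
      Real.norm_of_nonneg hρ0]
    nlinarith [norm_nonneg z]
  have h1 := hc _ hz'
  have h2 := h1.summable.sum_add_tsum_nat_add N
  rw [h1.tsum_eq] at h2
  have h3 : (∑ n ∈ Finset.range N, Polynomial.C (c n * ρ ^ n) * Polynomial.X ^ n).eval z =
      ∑ n ∈ Finset.range N, c n * (ρ * z) ^ n := by
    rw [Polynomial.eval_finsetSum]
    refine Finset.sum_congr rfl fun n _ => ?_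
    simp [mul_pow]; ring
  rw [h3, ← h2, sub_add_cancel_left, norm_neg]
  have hb : ∀ n, ‖c (n + N) * (ρ * z) ^ (n + N)‖ ≤ ‖c (n + N)‖ * ρ ^ (n + N) := fun n => by
    rw [norm_mul, norm_pow, norm_mul, Complex.norm_real, Real.norm_of_nonneg hρ0]
    have : ρ * ‖z‖ ≤ ρ := mul_le_of_le_one_right hρ0 hz
    gcongr
  have hsN := (summable_nat_add_iff (f := fun n => ‖c n‖ * ρ ^ n) N).2 hs
  exact (tsum_of_norm_bounded hsN.hasSum hb).trans hN.le

/-- Every function of `H¹` is a product of two power series with square summable coefficients. -/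
theorem exists_eq_powSum_mul_powSum {g : ℂ → ℂ} (hg : g ∈ hardySpace) :
    ∃ a b : ℕ → ℂ, (Summable fun n => ‖a n‖ ^ 2) ∧ (Summable fun n => ‖b n‖ ^ 2) ∧
      ∀ z ∈ disc, g z = powSum a z * powSum b z := by
  obtain ⟨hd, hfin⟩ := hg
  have hd : DifferentiableOn ℂ g disc := hd
  set ρ : ℕ → ℝ := fun k => 1 - 1 / ((k : ℝ) + 1) with hρdef
  have hε : ∀ k : ℕ, 0 < 1 / ((k : ℝ) + 1) := fun k => by positivity
  have hε1 : ∀ k : ℕ, 1 / ((k : ℝ) + 1) ≤ 1 := fun k => by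
    rw [div_le_one (by positivity)]; linarith [(Nat.cast_nonneg k : (0 : ℝ) ≤ k)]
  have hρ0 : ∀ k, 0 ≤ ρ k := fun k => by linarith [hε1 k]
  have hρ1 : ∀ k, ρ k < 1 := fun k => by linarith [hε k]
  choose p hp using fun k => exists_polynomial_approx hd (hρ0 k) (hρ1 k) (hε k)
  -- The summand `1` covers the approximation errors `1/(k + 1) ≤ 1`, so that `A` serves every `k`.
  set A := (hardyNorm g).toReal + 1 with hA
  have hpA : ∀ k, ∫ θ, ‖(p k).eval (circleMap 0 1 θ)‖ ∂circleMeasure ≤ A := by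
    intro k
    have hcg : Continuous fun θ => ‖g (circleMap 0 (ρ k) θ)‖ :=
      (hd.continuousOn.comp_continuous (continuous_circleMap 0 _)
        fun θ => circleMap_mem_disc (hρ0 k) (hρ1 k) θ).norm
    have hle : ∫⁻ θ, ‖g (circleMap 0 (ρ k) θ)‖ₑ ∂circleMeasure ≤ hardyNorm g :=
      le_iSup₂ (f := fun r (_ : r ∈ Ico (0 : ℝ) 1) =>
        ∫⁻ θ, ‖g (circleMap 0 r θ)‖ₑ ∂circleMeasure) (ρ k) ⟨hρ0 k, hρ1 k⟩
    have hi : Integrable (fun θ => ‖g (circleMap 0 (ρ k) θ)‖) circleMeasure :=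
      ⟨hcg.aestronglyMeasurable, by
        rw [HasFiniteIntegral]; simpa using hle.trans_lt hfin⟩
    have h1 : ∫ θ, ‖g (circleMap 0 (ρ k) θ)‖ ∂circleMeasure ≤ (hardyNorm g).toReal := by
      rw [integral_eq_lintegral_of_nonneg_ae (ae_of_all _ fun _ => norm_nonneg _)
        hcg.aestronglyMeasurable]
      exact ENNReal.toReal_mono hfin.ne (by simpa using hle)
    calc ∫ θ, ‖(p k).eval (circleMap 0 1 θ)‖ ∂circleMeasure
        ≤ ∫ θ, (‖g (circleMap 0 (ρ k) θ)‖ + 1) ∂circleMeasure := by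
          refine integral_mono (integrable_norm_polynomial _ _) (hi.add (integrable_const _))
            fun θ => ?_
          have h2 := hp k (circleMap 0 1 θ) (by simp)
          rw [← circleMap_eq_mul] at h2
          have h3 := norm_le_norm_add_norm_sub (g (circleMap 0 (ρ k) θ))
            ((p k).eval (circleMap 0 1 θ))
          rw [norm_sub_rev] at h3
          exact h3.trans (by linarith [hε1 k])
      _ = (∫ θ, ‖g (circleMap 0 (ρ k) θ)‖ ∂circleMeasure) + 1 := by
          rw [integral_add hi (integrable_const _)]; simp
      _ ≤ A := by linarith
  have hfac : ∀ k, ∃ a b : ℕ → ℂ, (∀ N, ∑ n ∈ Finset.range N, ‖a n‖ ^ 2 ≤ A) ∧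
      (∀ N, ∑ n ∈ Finset.range N, ‖b n‖ ^ 2 ≤ A) ∧
      ∀ z ∈ disc, (p k).eval z = powSum a z * powSum b z := by
    intro k
    obtain ⟨q, F, G, dF, dG, h1, h2⟩ := hasBalancedFactorization (p k)
    have hq : ∫ θ, ‖q.eval (circleMap 0 1 θ)‖ ∂circleMeasure ≤ A := by
      refine le_trans (le_of_eq ?_) (hpA k)
      refine integral_congr_ae (ae_of_all _ fun θ => h2 _ (by simp))
    obtain ⟨a, ha, eF⟩ := exists_powSum_of_normSq_le dF (fun z hz => (h1 z hz).2.1) hq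
    obtain ⟨b, hb, eG⟩ := exists_powSum_of_normSq_le dG (fun z hz => (h1 z hz).2.2) hq
    exact ⟨a, b, ha, hb, fun z hz => by rw [(h1 z hz).1, eF z hz, eG z hz]⟩
  choose a b ha hb hab using hfac
  -- The same ultrafilter for both factors spares the extraction of a common subsequence; the
  -- products then converge along it to `g`.
  obtain ⟨a', ha', hta⟩ := exists_tendsto_powSum (hyperfilter ℕ) ha
  obtain ⟨b', hb', htb⟩ := exists_tendsto_powSum (hyperfilter ℕ) hb
  refine ⟨a', b', summable_of_sum_normSq_le ha', summable_of_sum_normSq_le hb', fun z hz => ?_⟩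
  have ht1 := (hta z hz).mul (htb z hz)
  simp only [← hab _ z hz] at ht1
  have hz' : ‖z‖ < 1 := by simpa [disc] using hz
  have hε0 : Tendsto (fun k : ℕ => 1 / ((k : ℝ) + 1)) atTop (𝓝 0) :=
    tendsto_one_div_add_atTop_nhds_zero_nat
  have ht2 : Tendsto (fun k => g (ρ k * z)) atTop (𝓝 (g z)) := by
    have hc : ContinuousAt g z :=
      (hd.differentiableAt (Metric.isOpen_ball.mem_nhds hz)).continuousAt
    refine hc.tendsto.comp ?_
    have : Tendsto (fun k => ((ρ k : ℝ) : ℂ)) atTop (𝓝 ((1 : ℝ) : ℂ)) := by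
      refine (Complex.continuous_ofReal.tendsto _).comp ?_
      simpa [hρdef] using (tendsto_const_nhds (x := (1 : ℝ))).sub hε0
    simpa using this.mul_const z
  have ht3 : Tendsto (fun k => (p k).eval z) atTop (𝓝 (g z)) := by
    have h4 : Tendsto (fun k => (p k).eval z - g (ρ k * z)) atTop (𝓝 0) :=
      squeeze_zero_norm (fun k => hp k z hz'.le) hε0
    simpa using h4.add ht2
  exact tendsto_nhds_unique (ht3.mono_left (Nat.hyperfilter_le_atTop)) ht1

/-! ### Monotonicity of circle means. -/

/-- The mean of `‖g‖` over the circle of radius `r`. -/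
noncomputable def circleMean (g : ℂ → ℂ) (r : ℝ) : ℝ≥0∞ :=
  ∫⁻ θ, ‖g (circleMap 0 r θ)‖ₑ ∂circleMeasure

theorem circleMean_le_hardyNorm (g : ℂ → ℂ) {r : ℝ} (hr : r ∈ Ico (0 : ℝ) 1) :
    circleMean g r ≤ hardyNorm g :=
  le_iSup₂ (f := fun r (_ : r ∈ Ico (0 : ℝ) 1) => circleMean g r) r hr

theorem continuous_comp_circleMap {g : ℂ → ℂ} (hg : ContinuousOn g disc) {r : ℝ} (hr0 : 0 ≤ r)
    (hr : r < 1) : Continuous fun θ => g (circleMap 0 r θ) :=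
  hg.comp_continuous (continuous_circleMap 0 r) fun θ => circleMap_mem_disc hr0 hr θ

theorem exists_bound_of_lt_one {g : ℂ → ℂ} (hg : ContinuousOn g disc) {r : ℝ} (hr : r < 1) :
    ∃ K, 0 ≤ K ∧ ∀ z, ‖z‖ ≤ r → ‖g z‖ ≤ K := by
  obtain ⟨C, hC⟩ := (isCompact_closedBall (0 : ℂ) r).exists_bound_of_continuousOn
    (hg.mono (Metric.closedBall_subset_ball hr))
  exact ⟨max C 0, le_max_right _ _, fun z hz => (hC z (by simpa using hz)).trans (le_max_left _ _)⟩

theorem integrable_comp_circleMap {g : ℂ → ℂ} (hg : ContinuousOn g disc) {r : ℝ} (hr0 : 0 ≤ r)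
    (hr : r < 1) : Integrable (fun θ => g (circleMap 0 r θ)) circleMeasure := by
  obtain ⟨K, -, hK⟩ := exists_bound_of_lt_one hg hr
  exact Integrable.of_bound (continuous_comp_circleMap hg hr0 hr).aestronglyMeasurable K
    (ae_of_all _ fun θ => hK _ (by simp [abs_of_nonneg hr0]))

theorem circleMean_eq_ofReal {g : ℂ → ℂ} (hg : ContinuousOn g disc) {r : ℝ} (hr0 : 0 ≤ r)
    (hr : r < 1) :
    circleMean g r = ENNReal.ofReal (∫ θ, ‖g (circleMap 0 r θ)‖ ∂circleMeasure) := by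
  rw [ofReal_integral_eq_lintegral_ofReal (integrable_comp_circleMap hg hr0 hr).norm
    (ae_of_all _ fun _ => norm_nonneg _)]
  simp [circleMean]

theorem integral_norm_comp_mul_circleMap (g : ℂ → ℂ) (r α : ℝ) :
    ∫ θ, ‖g (circleMap 0 r α * circleMap 0 1 θ)‖ ∂circleMeasure =
      ∫ θ, ‖g (circleMap 0 r θ)‖ ∂circleMeasure := by
  rw [integral_circleMeasure, integral_circleMeasure,
    ← Real.circleAverage_def (f := fun z => ‖g z‖), Real.circleAverage_eq_integral_add α]
  congr 2
  ext θ
  congr 2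
  simp only [circleMap, zero_add, Complex.ofReal_add, add_mul, Complex.exp_add]
  push_cast
  ring

/-- Integration of the rotations of a holomorphic function against a bounded function. -/
theorem differentiableOn_integral_rotation {g : ℂ → ℂ} (hg : DifferentiableOn ℂ g disc)
    {φ : ℝ → ℂ} (hφ : Measurable φ) (bφ : ∀ θ, ‖φ θ‖ ≤ 1) :
    DifferentiableOn ℂ (fun z => ∫ θ, g (z * circleMap 0 1 θ) * φ θ ∂circleMeasure) disc := by
  intro z₀ hz₀
  have hz₀' : ‖z₀‖ < 1 := by simpa [disc] using hz₀
  obtain ⟨R, hR1, hR2⟩ := exists_between hz₀'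
  have hζ : Measurable fun θ : ℝ => (circleMap 0 1 θ : ℂ) := (continuous_circleMap 0 1).measurable
  have hm : ∀ z θ, ‖z * circleMap 0 1 θ‖ = ‖z‖ := fun z θ => by simp
  have hmem : ∀ z, ‖z‖ < 1 → ∀ θ, z * circleMap 0 1 θ ∈ disc := fun z hz θ => by
    simpa [disc] using hz
  have hcont : ∀ f : ℂ → ℂ, ContinuousOn f disc → ∀ z, ‖z‖ < 1 →
      Continuous fun θ => f (z * circleMap 0 1 θ) := fun f hf z hz =>
    hf.comp_continuous (continuous_const.mul (continuous_circleMap 0 1)) (hmem z hz)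
  have hd : DifferentiableOn ℂ (deriv g) disc := hg.deriv Metric.isOpen_ball
  obtain ⟨C, hC0, hC⟩ := exists_bound_of_lt_one hd.continuousOn hR2
  obtain ⟨K, hK0, hK⟩ := exists_bound_of_lt_one hg.continuousOn hR2
  have hball : Metric.ball (0 : ℂ) R ∈ 𝓝 z₀ := Metric.isOpen_ball.mem_nhds (by simpa using hR1)
  have key := hasDerivAt_integral_of_dominated_loc_of_deriv_le (μ := circleMeasure) (𝕜 := ℂ)
    (F := fun z θ => g (z * circleMap 0 1 θ) * φ θ) (x₀ := z₀)
    (F' := fun z θ => deriv g (z * circleMap 0 1 θ) * circleMap 0 1 θ * φ θ)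
    (bound := fun _ => C) hball ?_ ?_ ?_ ?_ (integrable_const _) ?_
  · exact key.2.differentiableAt.differentiableWithinAt
  · filter_upwards [hball] with z hz
    have hz : ‖z‖ < R := by simpa using hz
    exact ((hcont g hg.continuousOn z (hz.trans hR2)).measurable.mul hφ).aestronglyMeasurable
  · refine Integrable.of_bound (C := K * 1)
      ((hcont g hg.continuousOn z₀ hz₀').measurable.mul hφ).aestronglyMeasurable
      (ae_of_all _ fun θ => ?_)
    rw [norm_mul]
    exact mul_le_mul (hK _ ((hm _ _).trans_le hR1.le)) (bφ θ) (norm_nonneg _) hK0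
  · exact (((hcont _ hd.continuousOn z₀ hz₀').measurable.mul hζ).mul hφ).aestronglyMeasurable
  · refine ae_of_all _ fun θ z hz => ?_
    have hz : ‖z‖ < R := by simpa using hz
    rw [norm_mul, norm_mul]
    have h1 := hC _ ((hm z θ).trans_le hz.le)
    have h2 : ‖(circleMap 0 1 θ : ℂ)‖ = 1 := by simp
    rw [h2, mul_one]
    calc _ ≤ C * 1 := mul_le_mul h1 (bφ θ) (norm_nonneg _) hC0
      _ = C := mul_one C
  · refine ae_of_all _ fun θ z hz => ?_
    have hz : ‖z‖ < R := by simpa using hz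
    have h1 : HasDerivAt g (deriv g (z * circleMap 0 1 θ)) (z * circleMap 0 1 θ) :=
      (hg.differentiableAt (Metric.isOpen_ball.mem_nhds (hmem z (hz.trans hR2) θ))).hasDerivAt
    have h2 : HasDerivAt (fun z => z * circleMap 0 1 θ) (circleMap 0 1 θ) z := by
      simpa using (hasDerivAt_id z).mul_const (circleMap 0 1 θ)
    exact (h1.comp z h2).mul_const _

/-- The means of a holomorphic function over circles increase with the radius. -/
theorem circleMean_mono {g : ℂ → ℂ} (hg : DifferentiableOn ℂ g disc) {s r : ℝ} (hs0 : 0 ≤ s)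
    (hsr : s ≤ r) (hr : r < 1) : circleMean g s ≤ circleMean g r := by
  rcases (hs0.trans hsr).eq_or_lt with h0 | hr0
  · rw [le_antisymm hsr (h0 ▸ hs0)]
  have hs := hsr.trans_lt hr
  have hc := continuous_comp_circleMap hg.continuousOn hs0 hs
  -- The conjugate phase of `g` on the circle of radius `s` (zero where `g` vanishes). The
  -- holomorphic `F(z) = ∫ g(z e^{iθ}) φ(θ)` then equals the mean at `z = s` and is bounded by the
  -- mean of radius `r` when `|z| = r`; the maximum principle concludes.
  set φ : ℝ → ℂ := fun θ => starRingEnd ℂ (g (circleMap 0 s θ)) / ‖g (circleMap 0 s θ)‖ with hφd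
  have hφ : Measurable φ :=
    (Complex.continuous_conj.comp hc).measurable.div
      (Complex.continuous_ofReal.comp hc.norm).measurable
  have bφ : ∀ θ, ‖φ θ‖ ≤ 1 := fun θ => by
    simp only [hφd, norm_div, RCLike.norm_conj, Complex.norm_real, norm_norm]
    exact div_self_le_one _
  have hφe : ∀ θ, g (circleMap 0 s θ) * φ θ = (‖g (circleMap 0 s θ)‖ : ℂ) := fun θ => by
    simp only [hφd]
    rw [← mul_div_assoc, Complex.mul_conj, Complex.normSq_eq_norm_sq]
    by_cases h : ‖g (circleMap 0 s θ)‖ = 0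
    · simp [h]
    · push_cast; field_simp
  have hF := differentiableOn_integral_rotation hg hφ bφ
  set F : ℂ → ℂ := fun z => ∫ θ, g (z * circleMap 0 1 θ) * φ θ ∂circleMeasure with hFd
  have hFs : F s = ((∫ θ, ‖g (circleMap 0 s θ)‖ ∂circleMeasure : ℝ) : ℂ) := by
    simp only [hFd, ← circleMap_eq_mul, hφe]
    exact integral_complex_ofReal
  have hdc : DiffContOnCl ℂ F (Metric.ball 0 r) :=
    (hF.mono (Metric.closedBall_subset_ball hr)).diffContOnCl_ball subset_rfl
  have hmax := Complex.norm_le_of_forall_mem_frontier_norm_le Metric.isBounded_ball hdc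
    (C := ∫ θ, ‖g (circleMap 0 r θ)‖ ∂circleMeasure) (z := (s : ℂ)) ?_ ?_
  · rw [hFs, Complex.norm_real] at hmax
    rw [circleMean_eq_ofReal hg.continuousOn hs0 hs,
      circleMean_eq_ofReal hg.continuousOn hr0.le hr]
    exact ENNReal.ofReal_le_ofReal ((le_abs_self _).trans hmax)
  · intro z hz
    rw [frontier_ball _ hr0.ne', mem_sphere_zero_iff_norm] at hz
    have hzc : z = circleMap 0 r (Complex.arg z) := by
      rw [circleMap, zero_add, ← hz, Complex.norm_mul_exp_arg_mul_I]
    rw [← integral_norm_comp_mul_circleMap g r (Complex.arg z), ← hzc]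
    refine norm_integral_le_of_norm_le ?_ (ae_of_all _ fun θ => ?_)
    · have hz1 : ∀ θ, z * circleMap 0 1 θ ∈ disc := fun θ => by simpa [disc, hz] using hr
      obtain ⟨K, -, hK⟩ := exists_bound_of_lt_one hg.continuousOn hr
      exact Integrable.of_bound (hg.continuousOn.comp_continuous
        (continuous_const.mul (continuous_circleMap 0 1)) hz1).norm.aestronglyMeasurable K
        (ae_of_all _ fun θ => by rw [norm_norm]; exact hK _ (by simp [hz]))
    · rw [norm_mul]
      exact mul_le_of_le_one_right (norm_nonneg _) (bφ θ)
  · rw [closure_ball _ hr0.ne', mem_closedBall_zero_iff, Complex.norm_real,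
      Real.norm_of_nonneg hs0]
    exact hsr

/-! ### Polar coordinates and the radial weight. -/

theorem lintegral_circleMeasure_comp_circleMap (f : ℂ → ℝ≥0∞) (r : ℝ) :
    ∫⁻ θ in Ioo (-Real.pi) Real.pi, f (circleMap 0 r θ) =
      ENNReal.ofReal (2 * Real.pi) * ∫⁻ θ, f (circleMap 0 r θ) ∂circleMeasure := by
  have hπ : (0 : ℝ) < 2 * Real.pi := by positivity
  have : Fact (0 < 2 * Real.pi) := ⟨hπ⟩
  set F : AddCircle (2 * Real.pi) → ℝ≥0∞ := fun x => f ((periodic_circleMap 0 r).lift x) with hF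
  have h1 := AddCircle.lintegral_preimage (2 * Real.pi) (-Real.pi) F
  have h2 := AddCircle.lintegral_preimage (2 * Real.pi) 0 F
  simp only [hF, Function.Periodic.lift_coe] at h1 h2
  rw [show -Real.pi + 2 * Real.pi = Real.pi by ring] at h1
  rw [zero_add] at h2
  rw [setLIntegral_congr (Ioo_ae_eq_Ioc (μ := volume)), h1, ← h2, circleMeasure_eq,
    lintegral_smul_measure, smul_eq_mul, ← mul_assoc,
    ENNReal.mul_inv_cancel (by simpa using hπ) ENNReal.ofReal_ne_top, one_mul]

/-- The area measure in polar coordinates. -/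
theorem lintegral_areaMeasure {f : ℂ → ℝ≥0∞} (hf : Measurable f) :
    ∫⁻ z, f z ∂areaMeasure =
      ∫⁻ r in Ioo (0 : ℝ) 1, ENNReal.ofReal (2 * r) *
        ∫⁻ θ, f (circleMap 0 r θ) ∂circleMeasure := by
  have hπ : (0 : ℝ) < Real.pi := Real.pi_pos
  have hF : Measurable (disc.indicator f) := hf.indicator Metric.isOpen_ball.measurableSet
  have hcm : Measurable fun p : ℝ × ℝ => circleMap 0 p.1 p.2 := by
    simp only [circleMap]
    exact Continuous.measurable (by fun_prop)
  have hsymm : ∀ p : ℝ × ℝ, Complex.polarCoord.symm p = circleMap 0 p.1 p.2 := fun p => by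
    rw [Complex.polarCoord_symm_apply, circleMap, zero_add, Complex.exp_mul_I,
      Complex.ofReal_cos, Complex.ofReal_sin]
  have h1 : ∫⁻ z, disc.indicator f z = ∫⁻ r in Ioi (0 : ℝ), ∫⁻ θ in Ioo (-Real.pi) Real.pi,
      ENNReal.ofReal r * disc.indicator f (circleMap 0 r θ) := by
    rw [← Complex.lintegral_comp_polarCoord_symm, polarCoord_target, Measure.volume_eq_prod,
      setLIntegral_prod]
    · simp only [hsymm, smul_eq_mul]
    · simp only [hsymm, smul_eq_mul]
      exact ((ENNReal.measurable_ofReal.comp measurable_fst).mul (hF.comp hcm)).aemeasurable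
  have h2 : ∀ r : ℝ, ∫⁻ θ in Ioo (-Real.pi) Real.pi,
      ENNReal.ofReal r * disc.indicator f (circleMap 0 r θ) =
      ENNReal.ofReal Real.pi * (ENNReal.ofReal (2 * r) *
        ∫⁻ θ, disc.indicator f (circleMap 0 r θ) ∂circleMeasure) := by
    intro r
    have hm : Measurable fun θ => disc.indicator f (circleMap 0 r θ) :=
      hF.comp (continuous_circleMap 0 r).measurable
    rw [lintegral_const_mul _ hm, lintegral_circleMeasure_comp_circleMap, ← mul_assoc, ← mul_assoc,
      mul_comm (ENNReal.ofReal r), ENNReal.ofReal_mul two_pos.le, ENNReal.ofReal_mul two_pos.le]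
    ring
  have h3 : ∫⁻ r in Ioi (0 : ℝ), ENNReal.ofReal Real.pi * (ENNReal.ofReal (2 * r) *
        ∫⁻ θ, disc.indicator f (circleMap 0 r θ) ∂circleMeasure) =
      ∫⁻ r in Ioo (0 : ℝ) 1, ENNReal.ofReal Real.pi * (ENNReal.ofReal (2 * r) *
        ∫⁻ θ, f (circleMap 0 r θ) ∂circleMeasure) := by
    rw [← lintegral_indicator measurableSet_Ioi, ← lintegral_indicator measurableSet_Ioo]
    refine lintegral_congr fun r => ?_
    by_cases hr0 : 0 < r
    · by_cases hr1 : r < 1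
      · have hd : ∀ θ, circleMap 0 r θ ∈ disc := fun θ => circleMap_mem_disc hr0.le hr1 θ
        simp [hr0, hr1, hd]
      · have hd : ∀ θ, circleMap 0 r θ ∉ disc := fun θ => by
          simpa [disc, abs_of_pos hr0] using not_lt.1 hr1
        simp [hr1, hd]
    · simp [hr0]
  rw [areaMeasure, lintegral_smul_measure,
    ← lintegral_indicator (show MeasurableSet disc from Metric.isOpen_ball.measurableSet), h1]
  simp only [h2]
  rw [h3, lintegral_const_mul' _ _ ENNReal.ofReal_ne_top, smul_eq_mul, ← mul_assoc,
    ENNReal.inv_mul_cancel (by simpa using hπ) ENNReal.ofReal_ne_top, one_mul]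

/-- Nonnegativity supplies integrability, so only continuity of `G` is needed at the endpoints: for
`p < 2` the weight blows up at `r = 1`. -/
theorem lintegral_deriv_of_nonneg {G G' : ℝ → ℝ} {a b : ℝ} (hab : a ≤ b)
    (hc : ContinuousOn G (Icc a b)) (hd : ∀ x ∈ Ioo a b, HasDerivAt G (G' x) x)
    (h0 : ∀ x ∈ Ioo a b, 0 ≤ G' x) :
    ∫⁻ x in Ioo a b, ENNReal.ofReal (G' x) = ENNReal.ofReal (G b - G a) := by
  have hi := intervalIntegral.integrableOn_deriv_of_nonneg hc hd h0
  have h := intervalIntegral.integral_eq_sub_of_hasDerivAt_of_le hab hc hd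
    ((intervalIntegrable_iff_integrableOn_Ioc_of_le hab).2 hi)
  rw [← h, intervalIntegral.integral_of_le hab, integral_Ioc_eq_integral_Ioo,
    ofReal_integral_eq_lintegral_ofReal (hi.mono_set Ioo_subset_Ioc_self)
      ((ae_restrict_iff' measurableSet_Ioo).2 (ae_of_all _ h0))]

/-- The radial density `2 (p - 1) r (1 - r²) ^ (p - 2)`, of total mass `1` on `(0, 1)`. -/
noncomputable def besovWeight (p r : ℝ) : ℝ := (p - 1) * (2 * r) * (1 - r ^ 2) ^ (p - 2)

theorem besovWeight_nonneg {p r : ℝ} (hp : 1 ≤ p) (hr0 : 0 ≤ r) (hr : r ≤ 1) :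
    0 ≤ besovWeight p r := by
  have : 0 ≤ 1 - r ^ 2 := by nlinarith
  exact mul_nonneg (mul_nonneg (by linarith) (by linarith)) (Real.rpow_nonneg this _)

theorem measurable_besovWeight (p : ℝ) : Measurable (besovWeight p) := by
  unfold besovWeight
  fun_prop

theorem lintegral_besovWeight {p s t : ℝ} (hp : 1 < p) (hs : 0 ≤ s) (hst : s ≤ t) (ht : t ≤ 1) :
    ∫⁻ r in Ioo s t, ENNReal.ofReal (besovWeight p r) =
      ENNReal.ofReal ((1 - s ^ 2) ^ (p - 1) - (1 - t ^ 2) ^ (p - 1)) := by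
  have hc : Continuous fun r : ℝ => -(1 - r ^ 2) ^ (p - 1) := by
    refine Continuous.neg (Continuous.rpow_const (by fun_prop) fun _ => Or.inr (by linarith))
  rw [lintegral_deriv_of_nonneg (G := fun r => -(1 - r ^ 2) ^ (p - 1)) (G' := besovWeight p) hst hc.continuousOn
    (fun x hx => ?_) fun x hx =>
      besovWeight_nonneg hp.le (hs.trans hx.1.le) (hx.2.le.trans ht)]
  · congr 1; ring
  · have hx0 : 0 < x := hs.trans_lt hx.1
    have hx1 : x < 1 := hx.2.trans_le ht
    have h1 : 0 < 1 - x ^ 2 := by nlinarith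
    have h2 : HasDerivAt (fun r : ℝ => 1 - r ^ 2) (-(2 * x)) x := by
      simpa using (hasDerivAt_pow 2 x).const_sub 1
    refine (h2.rpow_const (p := p - 1) (Or.inl h1.ne')).neg.congr_deriv ?_
    rw [besovWeight, show p - 1 - 1 = p - 2 by ring]
    ring

theorem lintegral_two_mul_div_sq {t : ℝ} (ht0 : 0 ≤ t) (ht : t < 1) :
    ∫⁻ r in Ioo 0 t, ENNReal.ofReal (2 * r / (1 - r ^ 2) ^ 2) =
      ENNReal.ofReal (1 / (1 - t ^ 2) - 1) := by
  have hpos : ∀ x ∈ Icc 0 t, 0 < 1 - x ^ 2 := fun x hx => by nlinarith [hx.1, hx.2]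
  rw [lintegral_deriv_of_nonneg (G := fun r => (1 - r ^ 2)⁻¹)
    (G' := fun r => 2 * r / (1 - r ^ 2) ^ 2) ht0
    (ContinuousOn.inv₀ (by fun_prop) fun x hx => (hpos x hx).ne') (fun x hx => ?_) fun x hx => ?_]
  · simp
  · have h2 : HasDerivAt (fun r : ℝ => 1 - r ^ 2) (-(2 * x)) x := by
      simpa using (hasDerivAt_pow 2 x).const_sub 1
    refine (h2.inv (hpos x (Ioo_subset_Icc_self hx)).ne').congr_deriv ?_
    rw [neg_neg]
  · have := hx.1
    positivity

/-- The integral over a radius of the `p`-th power of a function with the bounds `n` and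
`A / (1 - r²)`. -/
theorem lintegral_besovWeight_mul_le {p A n : ℝ} (hp : 1 < p) (hA : 0 < A) (hn : 0 < n)
    {k : ℝ → ℝ} (hk0 : ∀ r ∈ Ioo (0 : ℝ) 1, 0 ≤ k r) {s : Set ℝ} (hs : s ⊆ Ioo (0 : ℝ) 1)
    (hk1 : ∀ r ∈ s, k r ≤ n) (hk2 : ∀ r ∈ s, k r ≤ A / (1 - r ^ 2)) :
    ∫⁻ r in s, ENNReal.ofReal (besovWeight p r) * ENNReal.ofReal (k r ^ p) ≤
      ENNReal.ofReal (p * A ^ (p - 1) * n) := by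
  -- The bounds `n` and `A/(1 - r²)` cross at `1 - r² = A/n`; the cap `1` covers `n < A`, where the
  -- bound `n` is used throughout. Otherwise the outer part gives `A^(p-1) n` and the inner part at
  -- most `(p - 1) A^(p-1) n`.
  set δ := min 1 (A / n) with hδ
  have hδ0 : 0 < δ := lt_min one_pos (by positivity)
  have hδ1 : δ ≤ 1 := min_le_left _ _
  set t := √(1 - δ) with ht
  have ht0 : 0 ≤ t := Real.sqrt_nonneg _
  have htt : 1 - t ^ 2 = δ := by rw [ht, Real.sq_sqrt (by linarith)]; ring
  have ht1 : t < 1 := by nlinarith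
  have hp0 : 0 < p := by linarith
  have hsub : s ⊆ Ioo 0 t ∪ ({t} ∪ Ioo t 1) := fun r hr => by
    rcases lt_trichotomy r t with h | h | h
    · exact Or.inl ⟨(hs hr).1, h⟩
    · exact Or.inr (Or.inl h)
    · exact Or.inr (Or.inr ⟨h, (hs hr).2⟩)
  set f : ℝ → ℝ≥0∞ := fun r => if r < t then
    ENNReal.ofReal ((p - 1) * A ^ p) * ENNReal.ofReal (2 * r / (1 - r ^ 2) ^ 2)
    else ENNReal.ofReal (n ^ p) * ENNReal.ofReal (besovWeight p r) with hf
  have hfm : Measurable f := by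
    refine Measurable.ite measurableSet_Iio ?_ ?_
    · fun_prop
    · exact measurable_const.mul (ENNReal.measurable_ofReal.comp (measurable_besovWeight p))
  have hpt : ∀ r ∈ s, ENNReal.ofReal (besovWeight p r) * ENNReal.ofReal (k r ^ p) ≤ f r := by
    intro r hr
    have hr' := hs hr
    have hw := besovWeight_nonneg hp.le hr'.1.le hr'.2.le
    have hu : 0 < 1 - r ^ 2 := by nlinarith [hr'.1, hr'.2]
    simp only [hf]
    split_ifs with h
    · have hAp : 0 ≤ (p - 1) * A ^ p := mul_nonneg (by linarith) (by positivity)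
      rw [← ENNReal.ofReal_mul hw, ← ENNReal.ofReal_mul hAp]
      refine ENNReal.ofReal_le_ofReal ?_
      calc besovWeight p r * k r ^ p ≤ besovWeight p r * (A / (1 - r ^ 2)) ^ p := by
            have := Real.rpow_le_rpow (hk0 r hr') (hk2 r hr) hp0.le
            gcongr
        _ = _ := by
            rw [besovWeight, Real.div_rpow hA.le hu.le, Real.rpow_sub hu, Real.rpow_two]
            field_simp
    · rw [mul_comm]
      gcongr
      exacts [hk0 r hr', hk1 r hr]
  calc ∫⁻ r in s, ENNReal.ofReal (besovWeight p r) * ENNReal.ofReal (k r ^ p)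
      ≤ ∫⁻ r in s, f r := setLIntegral_mono hfm hpt
    _ ≤ ∫⁻ r in Ioo 0 t ∪ ({t} ∪ Ioo t 1), f r := lintegral_mono_set hsub
    _ ≤ (∫⁻ r in Ioo 0 t, f r) + ((∫⁻ r in {t}, f r) + ∫⁻ r in Ioo t 1, f r) :=
        (lintegral_union_le _ _ _).trans (add_le_add le_rfl (lintegral_union_le _ _ _))
    _ = ENNReal.ofReal ((p - 1) * A ^ p) * ENNReal.ofReal (1 / δ - 1) +
          ENNReal.ofReal (n ^ p) * ENNReal.ofReal (δ ^ (p - 1)) := by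
        congr 1
        · rw [setLIntegral_congr_fun measurableSet_Ioo (g := fun r =>
            ENNReal.ofReal ((p - 1) * A ^ p) * ENNReal.ofReal (2 * r / (1 - r ^ 2) ^ 2))
            fun r hr => by simp only [hf, hr.2, if_true],
            lintegral_const_mul' _ _ ENNReal.ofReal_ne_top, lintegral_two_mul_div_sq ht0 ht1, htt]
        · rw [setLIntegral_measure_zero _ _ (by simp), zero_add,
            setLIntegral_congr_fun measurableSet_Ioo (g := fun r =>
            ENNReal.ofReal (n ^ p) * ENNReal.ofReal (besovWeight p r))
            fun r hr => by simp only [hf, not_lt.2 hr.1.le, if_false],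
            lintegral_const_mul' _ _ ENNReal.ofReal_ne_top,
            lintegral_besovWeight hp ht0 ht1.le le_rfl, htt]
          congr 2
          rw [one_pow, sub_self, Real.zero_rpow (by linarith), sub_zero]
    _ = ENNReal.ofReal ((p - 1) * A ^ p * (1 / δ - 1) + n ^ p * δ ^ (p - 1)) := by
        have h1 : 0 ≤ (p - 1) * A ^ p := mul_nonneg (by linarith) (by positivity)
        have h2 : 0 ≤ 1 / δ - 1 := by
          rw [sub_nonneg, le_div_iff₀ hδ0]; linarith
        rw [ENNReal.ofReal_add (mul_nonneg h1 h2) (by positivity), ENNReal.ofReal_mul h1,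
          ENNReal.ofReal_mul (p := n ^ p) (by positivity)]
    _ ≤ _ := by
        refine ENNReal.ofReal_le_ofReal ?_
        have hAp : A ^ p = A ^ (p - 1) * A := by
          rw [← Real.rpow_add_one hA.ne']; congr 1; ring
        have hnp : n ^ p = n ^ (p - 1) * n := by
          rw [← Real.rpow_add_one hn.ne']; congr 1; ring
        have hA1 : 0 < A ^ (p - 1) := by positivity
        rcases le_total 1 (A / n) with h | h
        · have hδe : δ = 1 := min_eq_left h
          rw [hδe, Real.one_rpow, hnp]
          have hnA : n ≤ A := by rwa [le_div_iff₀ hn, one_mul] at h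
          have h1 : n ^ (p - 1) ≤ A ^ (p - 1) := Real.rpow_le_rpow hn.le hnA (by linarith)
          have h2 : n ^ (p - 1) * n ≤ A ^ (p - 1) * n := by gcongr
          have h3 : A ^ (p - 1) * n ≤ p * (A ^ (p - 1) * n) := by
            have : 0 < A ^ (p - 1) * n := by positivity
            nlinarith
          linarith
        · have hδe : δ = A / n := min_eq_right h
          rw [hδe, Real.div_rpow hA.le hn.le, hnp, hAp]
          have hn1 : 0 < n ^ (p - 1) := by positivity
          have e : (p - 1) * (A ^ (p - 1) * A) * (1 / (A / n) - 1) +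
              n ^ (p - 1) * n * (A ^ (p - 1) / n ^ (p - 1)) =
              p * A ^ (p - 1) * n - (p - 1) * A ^ (p - 1) * A := by
            field_simp; ring
          rw [e]
          have : 0 ≤ (p - 1) * A ^ (p - 1) * A :=
            mul_nonneg (mul_nonneg (by linarith) hA1.le) hA.le
          linarith

/-! ### Besov norms as weighted means, with bounds on both sides. -/

/-- The integral mean of `‖g‖ ^ p` which determines the Besov norm of a primitive of `g`. -/
noncomputable def besovMean (p : ℝ) (g : ℂ → ℂ) : ℝ≥0∞ :=
  ∫⁻ r in Ioo (0 : ℝ) 1, ENNReal.ofReal (besovWeight p r) *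
    ∫⁻ θ, ‖g (circleMap 0 r θ)‖ₑ ^ p ∂circleMeasure

theorem lintegral_mobiusMeasure {p : ℝ} (hp : 1 < p) (h : ℂ → ℂ) :
    ENNReal.ofReal (p - 1) *
      ∫⁻ z, ENNReal.ofReal (((1 - ‖z‖ ^ 2) * ‖deriv h z‖) ^ p) ∂mobiusMeasure =
      besovMean p (deriv h) := by
  have hg : Measurable (deriv h) := measurable_deriv h
  have m1 : Measurable fun z : ℂ => ENNReal.ofReal (1 / (1 - ‖z‖ ^ 2) ^ 2) := by fun_prop
  have m2 : Measurable fun z : ℂ => ENNReal.ofReal (((1 - ‖z‖ ^ 2) * ‖deriv h z‖) ^ p) := by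
    fun_prop
  rw [mobiusMeasure, lintegral_withDensity_eq_lintegral_mul _ m1 m2,
    lintegral_areaMeasure (m1.mul m2), ← lintegral_const_mul' _ _ ENNReal.ofReal_ne_top, besovMean]
  refine setLIntegral_congr_fun measurableSet_Ioo fun r hr => ?_
  have hu : 0 < 1 - r ^ 2 := by nlinarith [hr.1, hr.2]
  have h1 : ∀ θ, ((fun z : ℂ => ENNReal.ofReal (1 / (1 - ‖z‖ ^ 2) ^ 2)) *
      fun z : ℂ => ENNReal.ofReal (((1 - ‖z‖ ^ 2) * ‖deriv h z‖) ^ p)) (circleMap 0 r θ) =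
      ENNReal.ofReal ((1 - r ^ 2) ^ (p - 2)) * ‖deriv h (circleMap 0 r θ)‖ₑ ^ p := fun θ => by
    have hn : ‖circleMap 0 r θ‖ = r := by simp [abs_of_pos hr.1]
    simp only [Pi.mul_apply, hn]
    rw [← ofReal_norm, ENNReal.ofReal_rpow_of_nonneg (norm_nonneg _) (by linarith),
      ← ENNReal.ofReal_mul (by positivity), ← ENNReal.ofReal_mul (by positivity),
      Real.mul_rpow hu.le (norm_nonneg _), Real.rpow_sub hu, Real.rpow_two]
    congr 1
    ring
  simp only [h1]
  have hr2 : 0 ≤ 2 * r := by linarith [hr.1]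
  have hp1 : 0 ≤ p - 1 := by linarith
  rw [lintegral_const_mul' _ _ ENNReal.ofReal_ne_top, ← mul_assoc, ← mul_assoc,
    ← ENNReal.ofReal_mul hp1, ← ENNReal.ofReal_mul (by positivity), besovWeight]

theorem ofReal_mul_besovNorm {p : ℝ} (hp : 1 < p) (h : ℂ → ℂ) :
    ENNReal.ofReal (p - 1) * besovNorm p h =
      ENNReal.ofReal ((p - 1) ^ (1 - 1 / p)) * besovMean p (deriv h) ^ (1 / p) := by
  have hp1 : 0 < p - 1 := by linarith
  rw [← lintegral_mobiusMeasure hp h, ENNReal.mul_rpow_of_nonneg _ _ (by positivity), ← mul_assoc,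
    ENNReal.ofReal_rpow_of_nonneg hp1.le (by positivity), ← ENNReal.ofReal_mul (by positivity),
    ← Real.rpow_add hp1, besovNorm]
  simp

/-- The lower bound of the Besov norm by the mean over a circle. -/
theorem le_besovMean {g : ℂ → ℂ} (hg : DifferentiableOn ℂ g disc) {p s : ℝ} (hp : 1 < p)
    (hs0 : 0 ≤ s) (hs : s < 1) :
    ENNReal.ofReal ((1 - s ^ 2) ^ (p - 1)) * circleMean g s ^ p ≤ besovMean p g := by
  have hp0 : 0 < p := by linarith
  have hw := lintegral_besovWeight hp hs0 hs.le le_rfl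
  rw [one_pow, sub_self, Real.zero_rpow (by linarith), sub_zero] at hw
  have hwm : Measurable fun r => ENNReal.ofReal (besovWeight p r) :=
    ENNReal.measurable_ofReal.comp (measurable_besovWeight p)
  rw [← hw, ← lintegral_mul_const _ hwm, besovMean]
  refine le_trans ?_ (lintegral_mono_set (Ioo_subset_Ioo_left hs0))
  refine setLIntegral_mono' measurableSet_Ioo fun r hr => ?_
  have hr0 : 0 ≤ r := hs0.trans hr.1.le
  refine mul_le_mul_right ?_ _
  have h1 := circleMean_mono hg hs0 hr.1.le hr.2
  have hm : AEMeasurable (fun θ => ‖g (circleMap 0 r θ)‖ₑ) circleMeasure :=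
    (continuous_comp_circleMap hg.continuousOn hr0 hr.2).enorm.measurable.aemeasurable
  -- Hölder against the constant `1` on a probability space: the `L¹` mean is at most the `L^p`
  -- mean.
  have h2 := ENNReal.lintegral_mul_le_Lp_mul_Lq circleMeasure
    (Real.HolderConjugate.conjExponent hp) hm (g := fun _ => 1) aemeasurable_const
  simp only [Pi.mul_apply, mul_one, ENNReal.one_rpow, lintegral_const, measure_univ] at h2
  have h3 := ENNReal.rpow_le_rpow (h1.trans h2) hp0.le
  rwa [← ENNReal.rpow_mul, one_div_mul_cancel hp0.ne', ENNReal.rpow_one] at h3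

/-- The upper bound of the Besov norm by the radial maximal function. -/
theorem besovMean_le {g : ℂ → ℂ} (hg : Measurable g) {p A K s : ℝ} (hp : 1 < p)
    (hA : 0 < A) (hgA : ∀ z ∈ disc, ‖g z‖ ≤ A / (1 - ‖z‖ ^ 2)) (hs0 : 0 ≤ s) (hs : s < 1)
    (hK0 : 0 ≤ K) (hK : ∀ z, ‖z‖ ≤ s → ‖g z‖ ≤ K) :
    besovMean p g ≤ ENNReal.ofReal (K ^ p * (1 - (1 - s ^ 2) ^ (p - 1))) +
      ENNReal.ofReal (p * A ^ (p - 1)) *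
        ∫⁻ θ, radialMax (fun z => ‖g z‖ₑ) s θ ∂circleMeasure := by
  have hp0 : 0 < p := by linarith
  have hmem : ∀ r ∈ Ioo (0 : ℝ) 1, ∀ θ, circleMap 0 r θ ∈ disc := fun r hr θ =>
    circleMap_mem_disc hr.1.le hr.2 θ
  have hsub : Ioo (0 : ℝ) 1 ⊆ Ioo 0 s ∪ ({s} ∪ Ioo s 1) := fun r hr => by
    rcases lt_trichotomy r s with h | h | h
    · exact Or.inl ⟨hr.1, h⟩
    · exact Or.inr (Or.inl h)
    · exact Or.inr (Or.inr ⟨h, hr.2⟩)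
  rw [besovMean]
  refine (lintegral_mono_set hsub).trans ((lintegral_union_le _ _ _).trans (add_le_add ?_
    ((lintegral_union_le _ _ _).trans ?_)))
  · calc ∫⁻ r in Ioo 0 s, ENNReal.ofReal (besovWeight p r) *
          ∫⁻ θ, ‖g (circleMap 0 r θ)‖ₑ ^ p ∂circleMeasure
        ≤ ∫⁻ r in Ioo 0 s, ENNReal.ofReal (besovWeight p r) * ENNReal.ofReal (K ^ p) := by
          refine setLIntegral_mono' measurableSet_Ioo fun r hr => mul_le_mul_right ?_ _
          have h1 : ∀ θ, ‖g (circleMap 0 r θ)‖ₑ ^ p ≤ ENNReal.ofReal (K ^ p) := fun θ => by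
            rw [← ENNReal.ofReal_rpow_of_nonneg hK0 hp0.le, ← ofReal_norm]
            refine ENNReal.rpow_le_rpow (ENNReal.ofReal_le_ofReal (hK _ ?_)) hp0.le
            simpa [abs_of_pos hr.1] using hr.2.le
          refine (lintegral_mono h1).trans ?_
          simp
      _ = _ := by
          rw [lintegral_mul_const' _ _ ENNReal.ofReal_ne_top,
            lintegral_besovWeight hp le_rfl hs0 hs.le, mul_comm,
            ← ENNReal.ofReal_mul (by positivity)]
          simp
  · rw [setLIntegral_measure_zero _ _ (by simp), zero_add]
    have hmg : Measurable fun q : ℝ × ℝ => ‖g (circleMap 0 q.1 q.2)‖ₑ ^ p := by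
      refine ((hg.comp (Continuous.measurable ?_)).enorm).pow_const p
      simp only [circleMap]
      fun_prop
    calc ∫⁻ r in Ioo s 1, ENNReal.ofReal (besovWeight p r) *
          ∫⁻ θ, ‖g (circleMap 0 r θ)‖ₑ ^ p ∂circleMeasure
        = ∫⁻ r in Ioo s 1, ∫⁻ θ, ENNReal.ofReal (besovWeight p r) *
          ‖g (circleMap 0 r θ)‖ₑ ^ p ∂circleMeasure :=
          lintegral_congr fun r => (lintegral_const_mul' _ _ ENNReal.ofReal_ne_top).symm
      _ = ∫⁻ θ, (∫⁻ r in Ioo s 1, ENNReal.ofReal (besovWeight p r) *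
          ‖g (circleMap 0 r θ)‖ₑ ^ p) ∂circleMeasure := by
          refine lintegral_lintegral_swap (Measurable.aemeasurable ?_)
          exact ((ENNReal.measurable_ofReal.comp (measurable_besovWeight p)).comp
            measurable_fst).mul hmg
      _ ≤ ∫⁻ θ, ENNReal.ofReal (p * A ^ (p - 1)) * radialMax (fun z => ‖g z‖ₑ) s θ
          ∂circleMeasure := by
          refine lintegral_mono fun θ => ?_
          have hpA : 0 < p * A ^ (p - 1) := by positivity
          have heq : ∀ r, ‖g (circleMap 0 r θ)‖ₑ ^ p =
              ENNReal.ofReal (‖g (circleMap 0 r θ)‖ ^ p) := fun r => by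
            rw [← ENNReal.ofReal_rpow_of_nonneg (norm_nonneg _) hp0.le, ofReal_norm]
          simp only [heq]
          have hsub' : Ioo s 1 ⊆ Ioo (0 : ℝ) 1 := Ioo_subset_Ioo_left hs0
          have hA' : ∀ r ∈ Ioo s 1, ‖g (circleMap 0 r θ)‖ ≤ A / (1 - r ^ 2) := fun r hr => by
            have := hgA _ (hmem r (hsub' hr) θ)
            rwa [show ‖circleMap 0 r θ‖ = r by simp [abs_of_pos (hs0.trans_lt hr.1)]] at this
          by_cases htop : radialMax (fun z => ‖g z‖ₑ) s θ = ⊤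
          · rw [htop, ENNReal.mul_top (by simpa using hpA)]
            exact le_top
          set n := (radialMax (fun z => ‖g z‖ₑ) s θ).toReal with hn
          have hle : ∀ r ∈ Ioo s 1, ‖g (circleMap 0 r θ)‖ ≤ n := fun r hr => by
            have := le_radialMax (fun z => ‖g z‖ₑ) (Ioo_subset_Ico_self hr) θ
            rw [← toReal_enorm]
            exact ENNReal.toReal_mono htop this
          rw [← ENNReal.ofReal_toReal htop, ← ENNReal.ofReal_mul hpA.le, ← hn]
          -- The splitting radius involves `A / n`, so a vanishing maximal function is treated
          -- apart.
          rcases (ENNReal.toReal_nonneg : 0 ≤ n).eq_or_lt with h0 | hpos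
          · have hz : ∀ r ∈ Ioo s 1, ENNReal.ofReal (besovWeight p r) *
                ENNReal.ofReal (‖g (circleMap 0 r θ)‖ ^ p) = 0 := fun r hr => by
              rw [le_antisymm ((hle r hr).trans_eq h0.symm) (norm_nonneg _),
                Real.zero_rpow hp0.ne', ENNReal.ofReal_zero, mul_zero]
            rw [setLIntegral_congr_fun measurableSet_Ioo hz]
            simp
          · exact lintegral_besovWeight_mul_le hp hA hpos (fun r _ => norm_nonneg _) hsub' hle hA'
      _ = _ := lintegral_const_mul' _ _ ENNReal.ofReal_ne_top

/-! ### Growth, maximal function and boundary values in `H¹`. -/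

theorem exists_growth_bound {g : ℂ → ℂ} (hg : g ∈ hardySpace) :
    ∃ A : ℝ, 0 < A ∧ ∀ z ∈ disc, ‖g z‖ ≤ A / (1 - ‖z‖ ^ 2) := by
  obtain ⟨a, b, ha, hb, h⟩ := exists_eq_powSum_mul_powSum hg
  have ha0 : 0 ≤ ∑' n, ‖a n‖ ^ 2 := tsum_nonneg fun _ => by positivity
  have hb0 : 0 ≤ ∑' n, ‖b n‖ ^ 2 := tsum_nonneg fun _ => by positivity
  refine ⟨(∑' n, ‖a n‖ ^ 2 + 1) * (∑' n, ‖b n‖ ^ 2 + 1), by positivity, fun z hz => ?_⟩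
  have hz' : ‖z‖ < 1 := by simpa [disc] using hz
  have hu : 0 ≤ 1 - ‖z‖ ^ 2 := by nlinarith [norm_nonneg z]
  rw [h z hz, norm_mul]
  refine (mul_le_mul (norm_powSum_le ha hz') (norm_powSum_le hb hz') (norm_nonneg _)
    (by positivity)).trans_eq ?_
  rw [div_mul_div_comm, Real.mul_self_sqrt hu]

/-- Since `xy ≤ x² + y²`, the factorization reduces the `L¹` maximal function to two `L²` ones. -/
theorem lintegral_radialMax_lt_top {g : ℂ → ℂ} (hg : g ∈ hardySpace) :
    ∫⁻ θ, radialMax (fun z => ‖g z‖ₑ) 0 θ ∂circleMeasure < ⊤ := by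
  obtain ⟨a, b, ha, hb, h⟩ := exists_eq_powSum_mul_powSum hg
  have hle : ∀ θ, radialMax (fun z => ‖g z‖ₑ) 0 θ ≤
      radialMax (fun z => ‖powSum a z‖ₑ ^ 2) 0 θ + radialMax (fun z => ‖powSum b z‖ₑ ^ 2) 0 θ := by
    intro θ
    refine iSup₂_le fun r hr => ?_
    simp only
    rw [h _ (circleMap_mem_disc hr.1 hr.2 θ), enorm_mul]
    refine le_trans ?_ (add_le_add (le_radialMax (fun z => ‖powSum a z‖ₑ ^ 2) hr θ)
      (le_radialMax (fun z => ‖powSum b z‖ₑ ^ 2) hr θ))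
    generalize ‖powSum a (circleMap 0 r θ)‖ₑ = x
    generalize ‖powSum b (circleMap 0 r θ)‖ₑ = y
    rcases le_total x y with hxy | hxy
    · exact le_add_left (by rw [sq]; gcongr)
    · exact le_add_right (by rw [sq]; gcongr)
  refine (lintegral_mono hle).trans_lt ?_
  rw [lintegral_add_left (measurable_radialMax (continuousOn_enorm_sq_powSum ha) le_rfl)]
  exact ENNReal.add_lt_top.2
    ⟨(lintegral_radialMax_powSum_le ha).trans_lt ENNReal.ofReal_lt_top,
      (lintegral_radialMax_powSum_le hb).trans_lt ENNReal.ofReal_lt_top⟩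

/-- Fatou's theorem for `H¹`. -/
theorem ae_exists_tendsto_of_mem_hardySpace {g : ℂ → ℂ} (hg : g ∈ hardySpace) :
    ∀ᵐ θ ∂circleMeasure, ∃ w : ℂ,
      Tendsto (fun r : ℝ => g (circleMap 0 r θ)) (𝓝[<] (1 : ℝ)) (𝓝 w) := by
  obtain ⟨a, b, ha, hb, h⟩ := exists_eq_powSum_mul_powSum hg
  filter_upwards [ae_exists_tendsto_powSum ha, ae_exists_tendsto_powSum hb] with θ ⟨u, hu⟩ ⟨v, hv⟩
  refine ⟨u * v, (hu.mul hv).congr' ?_⟩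
  filter_upwards [Ico_mem_nhdsLT (zero_lt_one' ℝ)] with r hr
  exact (h _ (circleMap_mem_disc hr.1 hr.2 θ)).symm

theorem ae_tendsto_radialLimit {g : ℂ → ℂ} (hg : g ∈ hardySpace) :
    ∀ᵐ θ ∂circleMeasure,
      Tendsto (fun r : ℝ => g (circleMap 0 r θ)) (𝓝[<] (1 : ℝ)) (𝓝 (radialLimit g θ)) := by
  filter_upwards [ae_exists_tendsto_of_mem_hardySpace hg] with θ ⟨w, hw⟩
  rwa [radialLimit, hw.limUnder_eq]

theorem exists_seq_tendsto_one : ∃ ρ : ℕ → ℝ, (∀ k, ρ k ∈ Ico (0 : ℝ) 1) ∧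
    Tendsto ρ atTop (𝓝[<] 1) := by
  have h : ∀ k : ℕ, 1 - 1 / ((k : ℝ) + 1) ∈ Ico (0 : ℝ) 1 := fun k => by
    have h1 : 0 < 1 / ((k : ℝ) + 1) := by positivity
    have h2 : 1 / ((k : ℝ) + 1) ≤ 1 := by
      rw [div_le_one (by positivity)]; linarith [(Nat.cast_nonneg k : (0 : ℝ) ≤ k)]
    exact ⟨by linarith, by linarith⟩
  refine ⟨_, h, tendsto_nhdsWithin_iff.2 ⟨?_, Eventually.of_forall fun k => (h k).2⟩⟩
  simpa using (tendsto_const_nhds (x := (1 : ℝ))).sub (tendsto_one_div_add_atTop_nhds_zero_nat (𝕜 := ℝ))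

/-- Fatou's lemma gives this half; the reverse inequality is later read off from the Besov norms. -/
theorem lintegral_radialLimit_le {g : ℂ → ℂ} (hg : g ∈ hardySpace) :
    ∫⁻ θ, ‖radialLimit g θ‖ₑ ∂circleMeasure ≤ hardyNorm g := by
  obtain ⟨ρ, hρ, hρt⟩ := exists_seq_tendsto_one
  have hd : DifferentiableOn ℂ g disc := hg.1
  calc ∫⁻ θ, ‖radialLimit g θ‖ₑ ∂circleMeasure
      = ∫⁻ θ, liminf (fun k => ‖g (circleMap 0 (ρ k) θ)‖ₑ) atTop ∂circleMeasure := by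
        refine lintegral_congr_ae ?_
        filter_upwards [ae_tendsto_radialLimit hg] with θ hθ
        exact ((hθ.comp hρt).enorm.liminf_eq).symm
    _ ≤ liminf (fun k => circleMean g (ρ k)) atTop :=
        lintegral_liminf_le fun k =>
          (continuous_comp_circleMap hd.continuousOn (hρ k).1 (hρ k).2).enorm.measurable
    _ ≤ hardyNorm g := by
        refine (liminf_le_liminf (Eventually.of_forall fun k =>
          circleMean_le_hardyNorm g (hρ k))).trans ?_
        rw [liminf_const]

/-- The means of the radial maximal functions near the boundary tend to the boundary mean. -/
theorem exists_lintegral_radialMax_lt {g : ℂ → ℂ} (hg : g ∈ hardySpace) {c : ℝ≥0∞}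
    (hc : ∫⁻ θ, ‖radialLimit g θ‖ₑ ∂circleMeasure < c) :
    ∃ s ∈ Ico (0 : ℝ) 1, ∫⁻ θ, radialMax (fun z => ‖g z‖ₑ) s θ ∂circleMeasure < c := by
  obtain ⟨ρ, hρ, hρt⟩ := exists_seq_tendsto_one
  have hd : DifferentiableOn ℂ g disc := hg.1
  have hmono : ∀ s, 0 ≤ s → ∀ θ, radialMax (fun z => ‖g z‖ₑ) s θ ≤
      radialMax (fun z => ‖g z‖ₑ) 0 θ := fun s hs θ =>
    biSup_mono fun r hr => ⟨hs.trans hr.1, hr.2⟩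
  have key : Tendsto (fun k => ∫⁻ θ, radialMax (fun z => ‖g z‖ₑ) (ρ k) θ ∂circleMeasure) atTop
      (𝓝 (∫⁻ θ, ‖radialLimit g θ‖ₑ ∂circleMeasure)) := by
    -- The full maximal function is the integrable majorant; on a ray with a limit, suprema over
    -- `[s, 1)` converge to its absolute value.
    refine tendsto_lintegral_of_dominated_convergence (radialMax (fun z => ‖g z‖ₑ) 0)
      (fun k => measurable_radialMax hd.continuousOn.enorm (hρ k).1)
      (fun k => ae_of_all _ (hmono _ (hρ k).1)) (lintegral_radialMax_lt_top hg).ne ?_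
    filter_upwards [ae_tendsto_radialLimit hg] with θ hθ
    have hθ' := hθ.enorm
    refine tendsto_order.2 ⟨fun a ha => Eventually.of_forall fun k => ha.trans_le ?_,
      fun a ha => ?_⟩
    · refine le_of_tendsto hθ' ?_
      filter_upwards [Ico_mem_nhdsLT (hρ k).2] with r hr
      exact le_radialMax (fun z => ‖g z‖ₑ) hr θ
    · obtain ⟨b, hb1, hb2⟩ := exists_between ha
      obtain ⟨l, hl, hl2⟩ := (mem_nhdsLT_iff_exists_Ioo_subset (a := (1 : ℝ))).1
        (hθ'.eventually (gt_mem_nhds hb1))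
      filter_upwards [hρt.eventually (Ioo_mem_nhdsLT hl)] with k hk
      refine lt_of_le_of_lt (iSup₂_le fun r hr => ?_) hb2
      exact le_of_lt (hl2 ⟨hk.1.trans_le hr.1, hr.2⟩)
  obtain ⟨k, hk⟩ := (key.eventually (gt_mem_nhds hc)).exists
  exact ⟨ρ k, hρ k, hk⟩

/-! ### The limit `p → 1`. -/

/-- The exponent `1 - 1/p` equals `(p - 1)/p`, so the logarithm is `x log x / p` with `x = p - 1 →
0`. -/
theorem tendsto_rpow_one_sub_one_div :
    Tendsto (fun p : ℝ => (p - 1) ^ (1 - 1 / p)) (𝓝[>] 1) (𝓝 1) := by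
  have h1 : Tendsto (fun p : ℝ => Real.exp ((p - 1) * Real.log (p - 1) / p)) (𝓝[>] 1) (𝓝 1) := by
    have hc : ContinuousAt (fun p : ℝ => Real.exp ((p - 1) * Real.log (p - 1) / p)) 1 := by
      refine Real.continuous_exp.continuousAt.comp (ContinuousAt.div ?_ continuousAt_id one_ne_zero)
      exact (Real.continuous_mul_log.comp (continuous_sub_right (1 : ℝ))).continuousAt
    simpa using hc.tendsto.mono_left (nhdsWithin_le_nhds (s := Ioi 1))
  refine h1.congr' ?_
  filter_upwards [self_mem_nhdsWithin] with p hp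
  have hp : 1 < p := hp
  rw [Real.rpow_def_of_pos (by linarith)]
  congr 1
  field_simp

/-- Lower bound for the normalized Besov norms. -/
theorem exists_tendsto_le_besovNorm {h : ℂ → ℂ} (hg : DifferentiableOn ℂ (deriv h) disc) {s : ℝ}
    (hs0 : 0 ≤ s) (hs : s < 1) :
    ∃ φ : ℝ → ℝ≥0∞, Tendsto φ (𝓝[>] 1) (𝓝 (circleMean (deriv h) s)) ∧
      ∀ p, 1 < p → φ p ≤ ENNReal.ofReal (p - 1) * besovNorm p h := by
  rw [circleMean_eq_ofReal hg.continuousOn hs0 hs]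
  set m := ∫ θ, ‖deriv h (circleMap 0 s θ)‖ ∂circleMeasure with hm
  have hm0 : 0 ≤ m := integral_nonneg fun _ => norm_nonneg _
  have hu : 0 < 1 - s ^ 2 := by nlinarith
  refine ⟨fun p => ENNReal.ofReal ((p - 1) ^ (1 - 1 / p) * (((1 - s ^ 2) ^ (p - 1)) ^ (1 / p) * m)),
    ENNReal.tendsto_ofReal ?_, fun p hp => ?_⟩
  · have h2 : ContinuousAt (fun p : ℝ => ((1 - s ^ 2) ^ (p - 1)) ^ (1 / p) * m) 1 := by
      refine ContinuousAt.mul (ContinuousAt.rpow ?_ ?_ (Or.inl ?_)) continuousAt_const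
      · exact continuousAt_const.rpow (continuousAt_id.sub continuousAt_const) (Or.inl hu.ne')
      · exact continuousAt_const.div continuousAt_id one_ne_zero
      · simp
    simpa using tendsto_rpow_one_sub_one_div.mul (h2.tendsto.mono_left nhdsWithin_le_nhds)
  · have hp0 : 0 < p := by linarith
    have hp1 : 0 ≤ p - 1 := by linarith
    simp only
    rw [ofReal_mul_besovNorm hp, ENNReal.ofReal_mul (by positivity)]
    refine mul_le_mul_right ?_ _
    have h3 := ENNReal.rpow_le_rpow (le_besovMean hg hp hs0 hs) (z := 1 / p) (by positivity)
    rwa [ENNReal.mul_rpow_of_nonneg _ _ (by positivity), ← ENNReal.rpow_mul,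
      mul_one_div_cancel hp0.ne', ENNReal.rpow_one, circleMean_eq_ofReal hg.continuousOn hs0 hs,
      ← hm, ENNReal.ofReal_rpow_of_nonneg (by positivity) (by positivity),
      ← ENNReal.ofReal_mul (by positivity)] at h3

/-- Upper bound for the normalized Besov norms. -/
theorem exists_besovNorm_le {h : ℂ → ℂ} (hg : deriv h ∈ hardySpace) {s : ℝ} (hs0 : 0 ≤ s)
    (hs : s < 1) :
    ∃ A K n : ℝ, 0 < A ∧ 0 ≤ K ∧ 0 ≤ n ∧
      ENNReal.ofReal n = ∫⁻ θ, radialMax (fun z => ‖deriv h z‖ₑ) s θ ∂circleMeasure ∧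
      ∀ p, 1 < p → ENNReal.ofReal (p - 1) * besovNorm p h ≤
        ENNReal.ofReal ((p - 1) ^ (1 - 1 / p) *
          (K ^ p * (1 - (1 - s ^ 2) ^ (p - 1)) + p * A ^ (p - 1) * n) ^ (1 / p)) := by
  have hd : DifferentiableOn ℂ (deriv h) disc := hg.1
  obtain ⟨A, hA, hgA⟩ := exists_growth_bound hg
  obtain ⟨K, hK0, hK⟩ := exists_bound_of_lt_one hd.continuousOn hs
  have hfin : ∫⁻ θ, radialMax (fun z => ‖deriv h z‖ₑ) s θ ∂circleMeasure ≠ ⊤ := by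
    refine ne_top_of_le_ne_top (lintegral_radialMax_lt_top hg).ne (lintegral_mono fun θ => ?_)
    exact biSup_mono fun r hr => ⟨hs0.trans hr.1, hr.2⟩
  refine ⟨A, K, (∫⁻ θ, radialMax (fun z => ‖deriv h z‖ₑ) s θ ∂circleMeasure).toReal, hA, hK0,
    ENNReal.toReal_nonneg, ENNReal.ofReal_toReal hfin, fun p hp => ?_⟩
  set n := (∫⁻ θ, radialMax (fun z => ‖deriv h z‖ₑ) s θ ∂circleMeasure).toReal with hn
  have hn0 : 0 ≤ n := ENNReal.toReal_nonneg
  have hp0 : 0 < p := by linarith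
  have hp1 : 0 ≤ p - 1 := by linarith
  have hu0 : 0 ≤ 1 - s ^ 2 := by nlinarith
  have hu1 : (1 - s ^ 2) ^ (p - 1) ≤ 1 := Real.rpow_le_one hu0 (by nlinarith) hp1
  have hu2 : 0 ≤ 1 - (1 - s ^ 2) ^ (p - 1) := by linarith
  have h1 := besovMean_le (measurable_deriv h) hp hA hgA hs0 hs hK0 hK
  rw [← ENNReal.ofReal_toReal hfin, ← hn, ← ENNReal.ofReal_mul (by positivity),
    ← ENNReal.ofReal_add (by positivity) (by positivity)] at h1
  rw [ofReal_mul_besovNorm hp, ENNReal.ofReal_mul (by positivity)]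
  refine mul_le_mul_right ?_ _
  rw [← ENNReal.ofReal_rpow_of_nonneg (by positivity) (by positivity)]
  exact ENNReal.rpow_le_rpow h1 (by positivity)

theorem tendsto_upper_bound {A K n s : ℝ} (hA : 0 < A) (hs0 : 0 ≤ s)
    (hs : s < 1) :
    Tendsto (fun p : ℝ => (p - 1) ^ (1 - 1 / p) *
      (K ^ p * (1 - (1 - s ^ 2) ^ (p - 1)) + p * A ^ (p - 1) * n) ^ (1 / p)) (𝓝[>] 1) (𝓝 n) := by
  have hu : 0 < 1 - s ^ 2 := by nlinarith
  have hsub : ContinuousAt (fun p : ℝ => p - 1) 1 := continuousAt_id.sub continuousAt_const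
  have hKc : ContinuousAt (fun p : ℝ => K ^ p) 1 := Real.continuousAt_const_rpow' one_ne_zero
  have h2 : ContinuousAt (fun p : ℝ =>
      (K ^ p * (1 - (1 - s ^ 2) ^ (p - 1)) + p * A ^ (p - 1) * n) ^ (1 / p)) 1 := by
    refine ContinuousAt.rpow (ContinuousAt.add (hKc.mul (continuousAt_const.sub ?_)) ?_) ?_
      (Or.inr (by norm_num))
    · exact continuousAt_const.rpow hsub (Or.inl hu.ne')
    · exact (continuousAt_id.mul (continuousAt_const.rpow hsub (Or.inl hA.ne'))).mul
        continuousAt_const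
    · exact continuousAt_const.div continuousAt_id one_ne_zero
  simpa using tendsto_rpow_one_sub_one_div.mul (h2.tendsto.mono_left nhdsWithin_le_nhds)

theorem hardyNorm_le_of_besovNorm_le {h : ℂ → ℂ} (hg : DifferentiableOn ℂ (deriv h) disc)
    {C : ℝ≥0∞} (hC : ∀ p ∈ Ioc (1 : ℝ) 2, ENNReal.ofReal (p - 1) * besovNorm p h ≤ C) :
    hardyNorm (deriv h) ≤ C := by
  refine iSup₂_le fun s hs => ?_
  obtain ⟨φ, hφ, hle⟩ := exists_tendsto_le_besovNorm hg hs.1 hs.2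
  refine le_of_tendsto hφ ?_
  filter_upwards [Ioc_mem_nhdsGT one_lt_two] with p hp
  exact (hle p hp.1).trans (hC p hp)

theorem iSup_besovNorm_lt_top {h : ℂ → ℂ} (hg : deriv h ∈ hardySpace) :
    (⨆ p ∈ Ioc (1 : ℝ) 2, ENNReal.ofReal (p - 1) * besovNorm p h) < ⊤ := by
  -- With `s = 0` the inner disc contributes nothing, and the bound is uniform on `(1, 2]`.
  obtain ⟨A, K, n, hA, hK, hn, -, hle⟩ := exists_besovNorm_le hg le_rfl zero_lt_one
  refine lt_of_le_of_lt (iSup₂_le fun p hp => (hle p hp.1).trans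
    (ENNReal.ofReal_le_ofReal (?_ : _ ≤ 1 * (1 + 2 * (1 + A) * n)))) ENNReal.ofReal_lt_top
  have hp1 : 0 < p - 1 := by linarith [hp.1]
  have hp2 : p ≤ 2 := hp.2
  have hp0 : 0 < p := by linarith
  have h1 : 1 / p ≤ 1 := by rw [div_le_one hp0]; linarith
  have h2 : (p - 1) ^ (1 - 1 / p) ≤ 1 := Real.rpow_le_one hp1.le (by linarith) (by linarith)
  have h3 : A ^ (p - 1) ≤ 1 + A := by
    calc A ^ (p - 1) ≤ (1 + A) ^ (p - 1) := Real.rpow_le_rpow hA.le (by linarith) hp1.le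
      _ ≤ (1 + A) ^ (1 : ℝ) := Real.rpow_le_rpow_of_exponent_le (by linarith) (by linarith)
      _ = 1 + A := Real.rpow_one _
  have h4 : K ^ p * (1 - (1 - (0 : ℝ) ^ 2) ^ (p - 1)) + p * A ^ (p - 1) * n ≤
      1 + 2 * (1 + A) * n := by
    have : p * A ^ (p - 1) * n ≤ 2 * (1 + A) * n := by gcongr
    simp
    linarith
  have h5 : 0 ≤ K ^ p * (1 - (1 - (0 : ℝ) ^ 2) ^ (p - 1)) + p * A ^ (p - 1) * n := by
    simp; positivity
  have h6 : (1 : ℝ) ≤ 1 + 2 * (1 + A) * n := by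
    have : 0 ≤ 2 * (1 + A) * n := by positivity
    linarith
  refine mul_le_mul h2 ?_ (Real.rpow_nonneg h5 _) zero_le_one
  calc _ ≤ (1 + 2 * (1 + A) * n) ^ (1 / p) := Real.rpow_le_rpow h5 h4 (by positivity)
    _ ≤ (1 + 2 * (1 + A) * n) ^ (1 : ℝ) := Real.rpow_le_rpow_of_exponent_le h6 h1
    _ = _ := Real.rpow_one _

theorem deriv_mem_hol {h : ℂ → ℂ} (hh : h ∈ Hol) : deriv h ∈ Hol :=
  DifferentiableOn.deriv hh Metric.isOpen_ball

theorem eventually_besovNorm_lt {h : ℂ → ℂ} (hg : deriv h ∈ hardySpace) {c : ℝ≥0∞}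
    (hc : ∫⁻ θ, ‖radialLimit (deriv h) θ‖ₑ ∂circleMeasure < c) :
    ∀ᶠ p in 𝓝[>] (1 : ℝ), ENNReal.ofReal (p - 1) * besovNorm p h < c := by
  obtain ⟨s, hs, hlt⟩ := exists_lintegral_radialMax_lt hg hc
  obtain ⟨A, K, n, hA, hK, hn, hne, hle⟩ := exists_besovNorm_le hg hs.1 hs.2
  rw [← hne] at hlt
  have ht := ENNReal.tendsto_ofReal (tendsto_upper_bound (K := K) (n := n) hA hs.1 hs.2)
  filter_upwards [ht.eventually (gt_mem_nhds hlt), self_mem_nhdsWithin] with p h1 h2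
  exact (hle p h2).trans_lt h1

theorem eventually_lt_besovNorm {h : ℂ → ℂ} (hg : DifferentiableOn ℂ (deriv h) disc) {c : ℝ≥0∞}
    (hc : c < hardyNorm (deriv h)) :
    ∀ᶠ p in 𝓝[>] (1 : ℝ), c < ENNReal.ofReal (p - 1) * besovNorm p h := by
  obtain ⟨s, hs⟩ := lt_iSup_iff.1 hc
  obtain ⟨hsm, hs⟩ := lt_iSup_iff.1 hs
  obtain ⟨φ, hφ, hle⟩ := exists_tendsto_le_besovNorm hg hsm.1 hsm.2
  filter_upwards [hφ.eventually (lt_mem_nhds hs), self_mem_nhdsWithin] with p h1 h2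
  exact h1.trans_le (hle p h2)

/-- A value `c` strictly between the boundary mean and a larger `H¹` norm would lie both above and
below the normalized Besov norms for `p` near `1`. -/
theorem hPrimeSeminorm_eq {h : ℂ → ℂ} (hg : deriv h ∈ hardySpace) :
    hPrimeSeminorm h = hardyNorm (deriv h) := by
  refine le_antisymm (lintegral_radialLimit_le hg) (le_of_not_gt fun hlt => ?_)
  obtain ⟨c, hc1, hc2⟩ := exists_between hlt
  obtain ⟨p, hp1, hp2⟩ :=
    ((eventually_besovNorm_lt hg hc1).and (eventually_lt_besovNorm hg.1 hc2)).exists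
  exact lt_asymm hp1 hp2

end BesovHardy

theorem mainTheorem4 :
    BesovHardy.hPrime =
        {h : ℂ → ℂ | h ∈ BesovHardy.Hol ∧
          (⨆ p ∈ Ioc (1 : ℝ) 2, ENNReal.ofReal (p - 1) * BesovHardy.besovNorm p h) < ⊤} ∧
      ∀ h ∈ BesovHardy.hPrime,
        (∀ᵐ θ ∂BesovHardy.circleMeasure, ∃ w : ℂ,
          Tendsto (fun r : ℝ => deriv h (circleMap 0 r θ)) (𝓝[<] (1 : ℝ)) (𝓝 w)) ∧
        BesovHardy.hPrimeSeminorm h = BesovHardy.hardyNorm (deriv h) ∧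
        Tendsto (fun p : ℝ => ENNReal.ofReal (p - 1) * BesovHardy.besovNorm p h)
          (𝓝[>] (1 : ℝ)) (𝓝 (BesovHardy.hardyNorm (deriv h))) := by
  refine ⟨Set.ext fun h => ⟨fun hh => ⟨hh.1, BesovHardy.iSup_besovNorm_lt_top hh.2⟩, fun hh =>
    ⟨hh.1, BesovHardy.deriv_mem_hol hh.1, ?_⟩⟩, fun h hh =>
    ⟨BesovHardy.ae_exists_tendsto_of_mem_hardySpace hh.2, BesovHardy.hPrimeSeminorm_eq hh.2, ?_⟩⟩
  · refine (BesovHardy.hardyNorm_le_of_besovNorm_le (BesovHardy.deriv_mem_hol hh.1) fun p hp => ?_).trans_lt hh.2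
    exact le_iSup₂ (f := fun p (_ : p ∈ Ioc (1 : ℝ) 2) =>
      ENNReal.ofReal (p - 1) * BesovHardy.besovNorm p h) p hp
  · refine tendsto_order.2 ⟨fun c hc => BesovHardy.eventually_lt_besovNorm hh.2.1 hc, fun c hc =>
      BesovHardy.eventually_besovNorm_lt hh.2 ?_⟩
    rw [← BesovHardy.hPrimeSeminorm_eq hh.2] at hc
    exact hc
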